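/- **Setting.** Let $f:\mathbb R^n\to\mathbb R$ and $g:\mathbb R^n\to\mathbb R^m$ be continuously differentiable, let $A(x)=(\nabla g^{(1)}(x),\dots,\nabla g^{(m)}(x))\in\mathbb R^{n\times m}$, and fix $\mu>0$. Norms are Euclidean (spectral for matrices). Fix constants $0<\xi,\tau,\delta<1$, $0<\eta_1\le\eta_2<1$, $1<\gamma_1<\gamma_2$, $\gamma_n,\gamma_t>0$. Write $f_k=f(x_k)$, $\nabla f_k=\nabla f(x_k)$, $g_k=g(x_k)$, $A_k=A(x_k)$, $Y_k=\mathrm{diag}(y_k)$, $D_k=\mathrm{diag}(I,Y_k^{-1})$, $e=(1,\dots,1)^T$, $\tilde\sigma_k=\sigma_k/\xi^3$, and split $d\in\mathbb R^{n}\times\mathbb R^m$ as $d=(d_x;d_y)$. **Algorithm (ARCBIP on the barrier problem $\min f(x)-\mu\sum_i\ln y^{(i)}$ subject to $g(x)+y=0$, for fixed $\mu$).** Start from $x_0$, $y_0>0$, $\sigma_0>0$, $\nu_{-1}>0$. For each $k\ge 0$ there are a regularisation parameter $\sigma_k>0$, a symmetric matrix $B_k\in\mathbb R^{n\times n}$ (the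 Hessian of the Lagrangian in $x$ or an approximation of it) and a matrix $N_k\in\mathbb R^{(n+m)\times n}$ whose columns form an orthogonal basis of the null space of $(A_k^T\ \ I)$, and one iteration is as follows. 1. *Normal step* $n_k=(n_x;n_y)$ with $n_y\ge-\xi\tau y_k$. Put $$\mathrm{npred}_k(n)=\|g_k+y_k\|-\|g_k+y_k+A_k^Tn_x+n_y\|-\tfrac13\tilde\sigma_k\|D_kn\|^3 .$$ (a) If the problem of minimizing $\tfrac12\|g_k+y_k+A_k^Tn_x+n_y\|^2+\tfrac13\tilde\sigma_k\|D_kn\|^3$ subject to $n_y\ge-\xi\tau y_k$ has an optimal solution of the form $\binom{A_k}{Y_k^2}\omega$, then $n_k$ is of this form for some $\omega$. (b) $\mathrm{npred}_k(n_k)\ge\gamma_n\,\mathrm{npred}_k(\alpha_k^cn_k^c)$, where $n_k^c=-\binom{A_k}{Y_k^2}(g_k+y_k)$ and $\alpha_k^c$ minimizes $-\mathrm{npred}_k(\alpha n_k^c)$ over $\alpha\ge0$ with $\alpha n_y^c\ge-\xi\tau y_k$. 2. *Tangential step* $t_k=(t_x;t_y)$ with $A_k^Tt_x+t_y=0$ and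 $n_y+t_y\ge-\tau y_k$. Put $$\mathrm{tpred}_k(t)=-(\nabla f_k+B_kn_x)^Tt_x-\tfrac12t_x^TB_kt_x+\mu\bigl(e^TY_k^{-1}t_y-n_y^TY_k^{-2}t_y-\tfrac12t_y^TY_k^{-2}t_y\bigr)-\tfrac13\sigma_k\|D_kt\|^3 .$$ (c) $\mathrm{tpred}_k(t_k)\ge\gamma_t\,\mathrm{tpred}_k(\beta_k^cN_kp_k^c)$, where $p_k^c=N_k^T\binom{-(\nabla f_k+B_kn_x)}{\mu(Y_k^{-1}e-Y_k^{-2}n_y)}$ and $\beta_k^c$ minimizes $-\mathrm{tpred}_k(\beta N_kp_k^c)$ over $\beta\ge0$ with $n_y+\beta(N_kp_k^c)_y\ge-\tau y_k$. Set $d_k=n_k+t_k$. 3. *Penalty parameter.* With $\chi_k=-\nabla f_k^Tn_x-\tfrac12n_x^TB_kn_x+\mu(e^TY_k^{-1}n_y-\tfrac12n_y^TY_k^{-2}n_y)$ and $\Delta_k=\tfrac13\sigma_k(\|D_kt_k\|^3-\|D_kd_k\|^3)$, let $$\tilde\nu_k=\max\Bigl\{-\tfrac{\mathrm{tpred}_k(t_k)+\Delta_k+\chi_k}{(1-\delta)\mathrm{npred}_k(n_k)+\frac13\tilde\sigma_k\|D_kn_k\|^3},\;-\tfrac{\Delta_k}{\frac12\mathrm{npred}_k(n_k)+\frac13\tilde\sigma_k\|D_kn_k\|^3}\Bigr\}$$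 ($\tilde\nu_k=0$ if the denominators vanish); $\nu_k=\nu_{k-1}$ if $\tilde\nu_k\le\nu_{k-1}$, and $\nu_k=\max\{\tilde\nu_k,1.5\,\nu_{k-1}\}$ otherwise. 4. *Acceptance.* Let $\phi(x,y;\nu)=f(x)-\mu\sum_i\ln y^{(i)}+\nu\|g(x)+y\|$, $$m_k(d)=f_k+\nabla f_k^Td_x+\tfrac12d_x^TB_kd_x+\tfrac13\sigma_k\|D_kd\|^3-\mu\Bigl(\sum_i\ln y_k^{(i)}+e^TY_k^{-1}d_y-\tfrac12d_y^TY_k^{-2}d_y\Bigr)+\nu_k\|g_k+y_k+A_k^Td_x+d_y\|,$$ $$\rho_k=\frac{\phi(x_k,y_k;\nu_k)-\phi(x_k+d_x,y_k+d_y;\nu_k)}{m_k(0)-m_k(d_k)}$$ ($\rho_k=0$ if the denominator vanishes). If $\rho_k\ge\eta_1$, then $(x_{k+1},y_{k+1})=(x_k,y_k)+d_k$; otherwise $(x_{k+1},y_{k+1})=(x_k,y_k)$. 5. *Regularisation.* $\sigma_{k+1}\in(0,\sigma_k]$ if $\rho_k\ge\eta_2$; $\sigma_{k+1}\in[\sigma_k,\gamma_1\sigma_k]$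 if $\eta_1\le\rho_k<\eta_2$; $\sigma_{k+1}\in[\gamma_1\sigma_k,\gamma_2\sigma_k]$ if $\rho_k<\eta_1$. **Assumptions.** (A1) There is an open convex set $\mathcal X$ containing all $x_k$ on which $f$ and $g$ are differentiable and $\nabla f$, $g$ and $A$ are Lipschitz continuous. (A2) The sequence $(x_k)$ is infinite, $(f_k)$ is bounded below, and $(\nabla f_k)$, $(g_k)$, $(A_k)$, $(B_k)$ are bounded. (A3) There is $\gamma_N>0$ with $\|N_k\|\le\gamma_N$ and $\sigma_{\min}(N_k)\ge\gamma_N^{-1}$ for all $k$. **Theorem.** Under (A1)–(A3), $$\lim_{k\to\infty}\binom{A_k}{Y_k}(g_k+y_k)=0 .$$ -/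

import Mathlib

open Filter Topology

noncomputable section

namespace ARCBIP

/-- `ℝⁿ` with the Euclidean norm. -/
abbrev E (n : ℕ) : Type := EuclideanSpace ℝ (Fin n)

/-- Stacked vectors `(x; y) ∈ ℝⁿ × ℝᵐ` with the Euclidean norm `√(‖x‖² + ‖y‖²)`. -/
abbrev Stack (n m : ℕ) : Type := WithLp 2 (E n × E m)

/-- The stacked vector `(a; b)`. -/
def stack {n m : ℕ} (a : E n) (b : E m) : Stack n m := WithLp.toLp 2 (a, b)

/-- `Y v`, where `Y = diag(y)`. -/
def diagMul {m : ℕ} (y v : E m) : E m := WithLp.toLp 2 (fun i => y i * v i)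

/-- `Y⁻¹ v`, where `Y = diag(y)`. -/
def diagInv {m : ℕ} (y v : E m) : E m := WithLp.toLp 2 (fun i => v i / y i)

/-- `e = (1, …, 1)`. -/
def ones (m : ℕ) : E m := WithLp.toLp 2 (fun _ => 1)

/-- `D d = (d_x; Y⁻¹ d_y)`. -/
def scale {n m : ℕ} (y : E m) (d : Stack n m) : Stack n m := stack d.fst (diagInv y d.snd)

/-- `A(x)ᵀ`, the Jacobian of the constraint function `g` at `x`. -/
def conJac {n m : ℕ} (g : E n → E m) (x : E n) : E n →L[ℝ] E m := fderiv ℝ g x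

/-- `A(x) = (∇g⁽¹⁾(x), …, ∇g⁽ᵐ⁾(x))`, the matrix of constraint gradients as an operator
`ℝᵐ → ℝⁿ`: it is the transpose of the Jacobian. -/
def conGrad {n m : ℕ} (g : E n → E m) (x : E n) : E m →L[ℝ] E n :=
  ContinuousLinearMap.adjoint (conJac g x)

/-- `c(x, y) = g(x) + y`. -/
def resid {n m : ℕ} (g : E n → E m) (x : E n) (y : E m) : E m := g x + y

/-- `φ(x, y; ν) = f(x) - μ ∑ ln y⁽ⁱ⁾ + ν ‖g(x) + y‖`, the merit function. -/
def merit {n m : ℕ} (f : E n → ℝ) (g : E n → E m) (μ ν : ℝ) (x : E n) (y : E m) : ℝ :=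
  f x - μ * ∑ i, Real.log (y i) + ν * ‖resid g x y‖

/-- The constants of the algorithm, with their ranges; `γn`, `γt` are the constants of the normal
and tangential Cauchy decrease conditions. -/
structure Params where
  /-- the (fixed) barrier parameter -/
  μ : ℝ
  ξ : ℝ
  τ : ℝ
  δ : ℝ
  η₁ : ℝ
  η₂ : ℝ
  γ₁ : ℝ
  γ₂ : ℝ
  γn : ℝ
  γt : ℝ
  μ_pos : 0 < μ
  ξ_pos : 0 < ξ
  ξ_lt : ξ < 1
  τ_pos : 0 < τ
  τ_lt : τ < 1
  δ_pos : 0 < δ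
  δ_lt : δ < 1
  η₁_pos : 0 < η₁
  η₁_le : η₁ ≤ η₂
  η₂_lt : η₂ < 1
  γ₁_gt : 1 < γ₁
  γ₁_lt : γ₁ < γ₂
  γn_pos : 0 < γn
  γt_pos : 0 < γt

/-- What is known at the beginning of an iteration: the iterate `(x, y)`, the regularisation
parameter `σ`, the matrix `B` (the Hessian of the Lagrangian in `x` or its approximation), and the
null space basis matrix `N`. -/
structure State (n m : ℕ) where
  x : E n
  y : E m
  σ : ℝ
  B : E n →L[ℝ] E n
  N : E n →L[ℝ] Stack n m

/-- The columns of `N` form an orthogonal basis of the null space of `(A(x)ᵀ  I)`. -/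
structure IsNullBasis {n m : ℕ} (g : E n → E m) (x : E n) (N : E n →L[ℝ] Stack n m) : Prop where
  injective : Function.Injective N
  range_eq : ∀ z : Stack n m, conJac g x z.fst + z.snd = 0 ↔ ∃ p, N p = z
  orthogonal : ∀ i j : Fin n, i ≠ j →
    inner ℝ (N (EuclideanSpace.single i 1)) (N (EuclideanSpace.single j 1)) = 0

/-! ### The normal step -/

/-- `σ̃ = σ / ξ³`. -/
def sigmaT {n m : ℕ} (P : Params) (s : State n m) : ℝ := s.σ / P.ξ ^ 3

/-- The objective `½ ‖g + y + Aᵀ n_x + n_y‖² + ⅓ σ̃ ‖D n‖³` of the normal problem. -/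
def normalObj {n m : ℕ} (g : E n → E m) (P : Params) (s : State n m) (v : Stack n m) : ℝ :=
  1 / 2 * ‖resid g s.x s.y + conJac g s.x v.fst + v.snd‖ ^ 2
    + 1 / 3 * sigmaT P s * ‖scale s.y v‖ ^ 3

/-- The constraint `n_y ≥ -ξ τ y` of the normal problem. -/
def NormalFeasible {n m : ℕ} (P : Params) (s : State n m) (v : Stack n m) : Prop :=
  ∀ i, -(P.ξ * P.τ) * s.y i ≤ v.snd i

/-- The vector `(A; Y²) ω`. -/
def rangeVec {n m : ℕ} (g : E n → E m) (s : State n m) (ω : E m) : Stack n m :=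
  stack (conGrad g s.x ω) (diagMul s.y (diagMul s.y ω))

/-- Range space condition: `v` has the form `(A; Y²) ω` whenever the normal problem has an
optimal solution of that form. -/
def RangeSpaceCond {n m : ℕ} (g : E n → E m) (P : Params) (s : State n m)
    (v : Stack n m) : Prop :=
  (∃ ω, NormalFeasible P s (rangeVec g s ω) ∧
      IsMinOn (normalObj g P s) {w | NormalFeasible P s w} (rangeVec g s ω)) →
    ∃ ω, v = rangeVec g s ω

/-- The normal predicted reduction
`‖g + y‖ - ‖g + y + Aᵀ n_x + n_y‖ - ⅓ σ̃ ‖D n‖³`. -/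
def npred {n m : ℕ} (g : E n → E m) (P : Params) (s : State n m) (v : Stack n m) : ℝ :=
  ‖resid g s.x s.y‖ - ‖resid g s.x s.y + conJac g s.x v.fst + v.snd‖
    - 1 / 3 * sigmaT P s * ‖scale s.y v‖ ^ 3

/-- The steepest descent direction `n^c = -(A; Y²)(g + y)`. -/
def normalDir {n m : ℕ} (g : E n → E m) (s : State n m) : Stack n m :=
  -rangeVec g s (resid g s.x s.y)

/-- Normal Cauchy decrease condition: `npred(v) ≥ γn npred(α^c n^c)`, where `α^c` minimizes
`-npred(α n^c)` over the `α ≥ 0` for which `α n^c` is feasible. -/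
def NormalCauchyCond {n m : ℕ} (g : E n → E m) (P : Params) (s : State n m)
    (v : Stack n m) : Prop :=
  ∃ α ∈ {α : ℝ | 0 ≤ α ∧ NormalFeasible P s (α • normalDir g s)},
    IsMinOn (fun α : ℝ => -npred g P s (α • normalDir g s))
      {α : ℝ | 0 ≤ α ∧ NormalFeasible P s (α • normalDir g s)} α ∧
    P.γn * npred g P s (α • normalDir g s) ≤ npred g P s v

/-- `v` is an admissible (approximate) solution of the normal problem. -/
structure IsNormalStep {n m : ℕ} (g : E n → E m) (P : Params) (s : State n m)
    (v : Stack n m) : Prop where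
  feasible : NormalFeasible P s v
  range_space : RangeSpaceCond g P s v
  cauchy : NormalCauchyCond g P s v

/-! ### The tangential step -/

/-- The tangential predicted reduction of `t`, given the normal step `v`. -/
def tpred {n m : ℕ} (f : E n → ℝ) (P : Params) (s : State n m) (v t : Stack n m) : ℝ :=
  -inner ℝ (gradient f s.x + s.B v.fst) t.fst - 1 / 2 * inner ℝ t.fst (s.B t.fst)
    + P.μ * (inner ℝ (ones m) (diagInv s.y t.snd)
        - inner ℝ (diagInv s.y v.snd) (diagInv s.y t.snd)
        - 1 / 2 * ‖diagInv s.y t.snd‖ ^ 2)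
    - 1 / 3 * s.σ * ‖scale s.y t‖ ^ 3

/-- The constraint `n_y + t_y ≥ -τ y`. -/
def FractionToBoundary {n m : ℕ} (P : Params) (s : State n m) (v t : Stack n m) : Prop :=
  ∀ i, -P.τ * s.y i ≤ v.snd i + t.snd i

/-- The steepest descent direction
`p^c = -N_xᵀ (∇f + B n_x) + μ N_yᵀ (Y⁻¹ e - Y⁻² n_y)`. -/
def tangentDir {n m : ℕ} (f : E n → ℝ) (P : Params) (s : State n m) (v : Stack n m) : E n :=
  ContinuousLinearMap.adjoint s.N
    (stack (-(gradient f s.x + s.B v.fst))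
      (P.μ • (diagInv s.y (ones m) - diagInv s.y (diagInv s.y v.snd))))

/-- Tangential Cauchy decrease condition: `tpred(t) ≥ γt tpred(β^c N p^c)`, where `β^c` minimizes
`-tpred(β N p^c)` over the `β ≥ 0` with `n_y + β N_y p^c ≥ -τ y`. -/
def TangentCauchyCond {n m : ℕ} (f : E n → ℝ) (P : Params) (s : State n m)
    (v t : Stack n m) : Prop :=
  ∃ β ∈ {β : ℝ | 0 ≤ β ∧ FractionToBoundary P s v (β • s.N (tangentDir f P s v))},
    IsMinOn (fun β : ℝ => -tpred f P s v (β • s.N (tangentDir f P s v)))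
      {β : ℝ | 0 ≤ β ∧ FractionToBoundary P s v (β • s.N (tangentDir f P s v))} β ∧
    P.γt * tpred f P s v (β • s.N (tangentDir f P s v)) ≤ tpred f P s v t

/-- `t` is an admissible (approximate) solution of the tangential problem, given the normal
step `v`. -/
structure IsTangentStep {n m : ℕ} (f : E n → ℝ) (g : E n → E m) (P : Params) (s : State n m)
    (v t : Stack n m) : Prop where
  null_space : conJac g s.x t.fst + t.snd = 0
  boundary : FractionToBoundary P s v t
  cauchy : TangentCauchyCond f P s v t

/-! ### Merit function model, penalty parameter, acceptance -/

/-- The model `m(d)` of the merit function with penalty parameter `ν`. -/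
def model {n m : ℕ} (f : E n → ℝ) (g : E n → E m) (P : Params) (s : State n m) (ν : ℝ)
    (d : Stack n m) : ℝ :=
  f s.x + inner ℝ (gradient f s.x) d.fst + 1 / 2 * inner ℝ d.fst (s.B d.fst)
    + 1 / 3 * s.σ * ‖scale s.y d‖ ^ 3
    - P.μ * (∑ i, Real.log (s.y i) + inner ℝ (ones m) (diagInv s.y d.snd)
        - 1 / 2 * ‖diagInv s.y d.snd‖ ^ 2)
    + ν * ‖resid g s.x s.y + conJac g s.x d.fst + d.snd‖

/-- The predicted reduction `m(0) - m(d)`. -/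
def pred {n m : ℕ} (f : E n → ℝ) (g : E n → E m) (P : Params) (s : State n m) (ν : ℝ)
    (d : Stack n m) : ℝ :=
  model f g P s ν 0 - model f g P s ν d

/-- The actual reduction `φ(x, y; ν) - φ(x + d_x, y + d_y; ν)`. -/
def ared {n m : ℕ} (f : E n → ℝ) (g : E n → E m) (P : Params) (s : State n m) (ν : ℝ)
    (d : Stack n m) : ℝ :=
  merit f g P.μ ν s.x s.y - merit f g P.μ ν (s.x + d.fst) (s.y + d.snd)

/-- The ratio `ρ = ared / pred`. -/
def ratio {n m : ℕ} (f : E n → ℝ) (g : E n → E m) (P : Params) (s : State n m) (ν : ℝ)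
    (d : Stack n m) : ℝ :=
  ared f g P s ν d / pred f g P s ν d

/-- `χ = -∇fᵀ n_x - ½ n_xᵀ B n_x + μ (eᵀ Y⁻¹ n_y - ½ n_yᵀ Y⁻² n_y)`. -/
def chi {n m : ℕ} (f : E n → ℝ) (P : Params) (s : State n m) (v : Stack n m) : ℝ :=
  -inner ℝ (gradient f s.x) v.fst - 1 / 2 * inner ℝ v.fst (s.B v.fst)
    + P.μ * (inner ℝ (ones m) (diagInv s.y v.snd) - 1 / 2 * ‖diagInv s.y v.snd‖ ^ 2)

/-- The threshold `ν̃` for the penalty parameter. If the two denominators vanish, then the normal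
step is zero, and the convention `0 / 0 = 0` gives `ν̃ = 0` (no increase of the penalty
parameter). -/
def nuT {n m : ℕ} (f : E n → ℝ) (g : E n → E m) (P : Params) (s : State n m)
    (v t : Stack n m) : ℝ :=
  max
    (-((tpred f P s v t + 1 / 3 * s.σ * (‖scale s.y t‖ ^ 3 - ‖scale s.y (v + t)‖ ^ 3)
          + chi f P s v)
        / ((1 - P.δ) * npred g P s v + 1 / 3 * sigmaT P s * ‖scale s.y v‖ ^ 3)))
    (-((1 / 3 * s.σ * (‖scale s.y t‖ ^ 3 - ‖scale s.y (v + t)‖ ^ 3))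
        / (1 / 2 * npred g P s v + 1 / 3 * sigmaT P s * ‖scale s.y v‖ ^ 3)))

/-- The penalty update: keep `ν` if `ν̃ ≤ ν`, otherwise take `max {ν̃, 1.5 ν}`. -/
def nuUpdate (νprev νt : ℝ) : ℝ := if νt ≤ νprev then νprev else max νt (3 / 2 * νprev)

/-! ### The algorithm for a fixed barrier parameter -/

/-- The sequences produced by the algorithm: `st k` is the state at iteration `k`, `nstep k` and
`tstep k` are the normal and tangential steps, `ν k` the penalty parameter used in iteration `k`,
and `νinit` the initial penalty parameter. -/
structure Run (n m : ℕ) where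
  st : ℕ → State n m
  nstep : ℕ → Stack n m
  tstep : ℕ → Stack n m
  ν : ℕ → ℝ
  νinit : ℝ

/-- The trial step `d_k = n_k + t_k`. -/
def Run.step {n m : ℕ} (R : Run n m) (k : ℕ) : Stack n m := R.nstep k + R.tstep k

/-- The ratio `ρ_k`. -/
def Run.rho {n m : ℕ} (R : Run n m) (f : E n → ℝ) (g : E n → E m) (P : Params) (k : ℕ) : ℝ :=
  ratio f g P (R.st k) (R.ν k) (R.step k)

/-- `R` is an infinite run of the algorithm on the barrier problem with the fixed barrier
parameter `P.μ`. -/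
structure IsRun {n m : ℕ} (f : E n → ℝ) (g : E n → E m) (P : Params) (R : Run n m) : Prop where
  y_init : ∀ i, 0 < (R.st 0).y i
  ν_init : 0 < R.νinit
  σ_pos : ∀ k, 0 < (R.st k).σ
  B_symm : ∀ k u v, inner ℝ ((R.st k).B u) v = inner ℝ u ((R.st k).B v)
  N_basis : ∀ k, IsNullBasis g (R.st k).x (R.st k).N
  normal : ∀ k, IsNormalStep g P (R.st k) (R.nstep k)
  tangent : ∀ k, IsTangentStep f g P (R.st k) (R.nstep k) (R.tstep k)
  ν_zero : R.ν 0 = nuUpdate R.νinit (nuT f g P (R.st 0) (R.nstep 0) (R.tstep 0))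
  ν_succ : ∀ k, R.ν (k + 1) =
    nuUpdate (R.ν k) (nuT f g P (R.st (k + 1)) (R.nstep (k + 1)) (R.tstep (k + 1)))
  accept : ∀ k, P.η₁ ≤ R.rho f g P k →
    (R.st (k + 1)).x = (R.st k).x + (R.step k).fst ∧
    (R.st (k + 1)).y = (R.st k).y + (R.step k).snd
  reject : ∀ k, R.rho f g P k < P.η₁ →
    (R.st (k + 1)).x = (R.st k).x ∧ (R.st (k + 1)).y = (R.st k).y
  σ_very : ∀ k, P.η₂ ≤ R.rho f g P k → (R.st (k + 1)).σ ∈ Set.Icc 0 (R.st k).σ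
  σ_succ : ∀ k, P.η₁ ≤ R.rho f g P k → R.rho f g P k < P.η₂ →
    (R.st (k + 1)).σ ∈ Set.Icc (R.st k).σ (P.γ₁ * (R.st k).σ)
  σ_unsucc : ∀ k, R.rho f g P k < P.η₁ →
    (R.st (k + 1)).σ ∈ Set.Icc (P.γ₁ * (R.st k).σ) (P.γ₂ * (R.st k).σ)

/-! ### Assumptions -/

/-- (A1): `f` and `g` are differentiable on an open convex set containing all the iterates, on
which `∇f`, `g` and `A` are Lipschitz continuous. -/
def A1 {n m : ℕ} (f : E n → ℝ) (g : E n → E m) (R : Run n m) : Prop :=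
  ∃ X : Set (E n), IsOpen X ∧ Convex ℝ X ∧ (∀ k, (R.st k).x ∈ X) ∧
    DifferentiableOn ℝ f X ∧ DifferentiableOn ℝ g X ∧
    (∃ L, LipschitzOnWith L (gradient f) X) ∧
    (∃ L, LipschitzOnWith L g X) ∧
    (∃ L, LipschitzOnWith L (conGrad g) X)

/-- (A2): `f_k` is bounded below, and `∇f_k`, `g_k`, `A_k`, `B_k` are bounded. -/
def A2 {n m : ℕ} (f : E n → ℝ) (g : E n → E m) (R : Run n m) : Prop :=
  (∃ C : ℝ, ∀ k, C ≤ f (R.st k).x) ∧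
  (∃ C : ℝ, ∀ k, ‖gradient f (R.st k).x‖ ≤ C) ∧
  (∃ C : ℝ, ∀ k, ‖g (R.st k).x‖ ≤ C) ∧
  (∃ C : ℝ, ∀ k, ‖conGrad g (R.st k).x‖ ≤ C) ∧
  (∃ C : ℝ, ∀ k, ‖(R.st k).B‖ ≤ C)

/-- (A3): `‖N_k‖ ≤ γ_N` and `σ_min(N_k) ≥ γ_N⁻¹`; the latter says `‖N_k p‖ ≥ γ_N⁻¹ ‖p‖`
for all `p`. -/
def A3 {n m : ℕ} (R : Run n m) : Prop :=
  ∃ γ : ℝ, 0 < γ ∧ ∀ k, ‖(R.st k).N‖ ≤ γ ∧ ∀ p, γ⁻¹ * ‖p‖ ≤ ‖(R.st k).N p‖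

end ARCBIP

end

namespace ARCBIP

variable {n m : ℕ}

/-! ### Stacked vectors and diagonal scaling -/

/-! Write `c = g(x) + y`, `w = (A; Y) c`, and measure steps in the scaled norm `‖D d‖`. Three
estimates carry the proof.

Monotonicity. The penalty rule gives `pred ≥ δ ν npred`. The parameters `ν_k` may be unbounded, so
the merit function is divided by `ν_k - h`, where `h` is half of the initial penalty parameter,
after a multiple `h ‖c‖` has been reserved to bound the barrier terms from below. The result `Ψ_k`
(`IsRun.exists_lyapunov`) is nonincreasing, dominates `‖c_k‖`, and drops by at least `η₁ δ npred_k`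
at each accepted step. In particular `c_k` and `y_k` are bounded.

Scaling. Put `r = σ^{-1/2}` and suppose `r ≤ 1`. While `‖w‖ ≥ ε`, the Cauchy condition gives `npred
≥ κ r` (`exists_mul_le_npred`), and always `‖D d‖ ≤ C r` (`exists_scale_step_le`). Late accepted
steps with `‖w‖ ≥ ε` have small `npred`, hence large `σ`, and their length is at most a constant
times the drop of `Ψ`.

Contradiction. Suppose `‖w_k‖ ≥ 2ε` infinitely often. Start at such an index where `Ψ` has almost
reached its limit. The remaining drop bounds the remaining path length, and `w` is Lipschitz along
the iterates, so `‖w‖ ≥ ε` holds forever after and `x_k` converges. Near the limit point, continuous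
differentiability makes the linearization errors `o(r)` uniformly, so a large `σ` forces very
successful iterations and `σ` stays bounded. But accepted steps need ever larger `σ`, so eventually
all steps are rejected and `σ` grows geometrically, which is absurd
(`IsRun.false_of_eventually_successful`). -/

@[simp] lemma stack_fst (a : E n) (b : E m) : (stack a b).fst = a := rfl

@[simp] lemma stack_snd (a : E n) (b : E m) : (stack a b).snd = b := rfl

@[simp] lemma diagMul_apply (y v : E m) (i : Fin m) : diagMul y v i = y i * v i := rfl

@[simp] lemma diagInv_apply (y v : E m) (i : Fin m) : diagInv y v i = v i / y i := rfl

@[simp] lemma ones_apply (i : Fin m) : ones m i = 1 := rfl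

lemma norm_sq_stack (a : E n) (b : E m) : ‖stack a b‖ ^ 2 = ‖a‖ ^ 2 + ‖b‖ ^ 2 :=
  WithLp.prod_norm_sq_eq_of_L2 _

lemma norm_le_stack_left (a : E n) (b : E m) : ‖a‖ ≤ ‖stack a b‖ := by
  refine le_of_sq_le_sq ?_ (norm_nonneg _)
  rw [norm_sq_stack]; nlinarith [sq_nonneg ‖b‖]

lemma norm_le_stack_right (a : E n) (b : E m) : ‖b‖ ≤ ‖stack a b‖ := by
  refine le_of_sq_le_sq ?_ (norm_nonneg _)
  rw [norm_sq_stack]; nlinarith [sq_nonneg ‖a‖]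

lemma norm_stack_le (a : E n) (b : E m) : ‖stack a b‖ ≤ ‖a‖ + ‖b‖ := by
  refine le_of_sq_le_sq ?_ (by positivity)
  rw [norm_sq_stack]; nlinarith [norm_nonneg a, norm_nonneg b]

lemma diagInv_add (y u v : E m) : diagInv y (u + v) = diagInv y u + diagInv y v := by
  ext i; simp [add_div]

lemma diagInv_smul (y : E m) (a : ℝ) (v : E m) : diagInv y (a • v) = a • diagInv y v := by
  ext i; simp [mul_div_assoc]

@[simp] lemma diagInv_zero (y : E m) : diagInv y 0 = 0 := by
  ext i; simp

lemma diagMul_diagInv {y : E m} (hy : ∀ i, 0 < y i) (v : E m) : diagMul y (diagInv y v) = v := by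
  ext i; have := (hy i).ne'; simp; field_simp

lemma diagInv_diagMul {y : E m} (hy : ∀ i, 0 < y i) (v : E m) : diagInv y (diagMul y v) = v := by
  ext i; have := (hy i).ne'; simp; field_simp

lemma diagMul_sub_diagMul (y y' c c' : E m) :
    diagMul y c - diagMul y' c' = diagMul (y - y') c + diagMul y' (c - c') := by
  ext i; simp; ring

lemma abs_apply_le_norm (v : E m) (i : Fin m) : |v i| ≤ ‖v‖ := by
  simpa using PiLp.norm_apply_le v i

lemma norm_diagMul_le (y v : E m) : ‖diagMul y v‖ ≤ ‖y‖ * ‖v‖ := by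
  refine le_of_sq_le_sq ?_ (by positivity)
  rw [mul_pow, EuclideanSpace.real_norm_sq_eq, EuclideanSpace.real_norm_sq_eq v, Finset.mul_sum]
  refine Finset.sum_le_sum fun i _ => ?_
  rw [diagMul_apply, mul_pow]
  refine mul_le_mul_of_nonneg_right ?_ (sq_nonneg _)
  rw [← sq_abs]
  exact pow_le_pow_left₀ (abs_nonneg _) (abs_apply_le_norm y i) 2

lemma inner_diagMul (y c v : E m) : inner ℝ c (diagMul y v) = inner ℝ (diagMul y c) v := by
  simp only [PiLp.inner_apply, diagMul_apply, RCLike.inner_apply, conj_trivial]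
  exact Finset.sum_congr rfl fun i _ => by ring

lemma scale_add (y : E m) (u v : Stack n m) : scale y (u + v) = scale y u + scale y v := by
  simp only [scale, WithLp.add_fst, WithLp.add_snd, diagInv_add]; rfl

lemma scale_smul (y : E m) (a : ℝ) (v : Stack n m) : scale y (a • v) = a • scale y v := by
  simp only [scale, WithLp.smul_fst, WithLp.smul_snd, diagInv_smul]; rfl

@[simp] lemma scale_zero (y : E m) : scale y (0 : Stack n m) = 0 := by
  simpa using scale_smul y 0 (0 : Stack n m)

lemma norm_fst_le_scale (y : E m) (v : Stack n m) : ‖v.fst‖ ≤ ‖scale y v‖ :=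
  norm_le_stack_left _ _

lemma norm_diagInv_le_scale (y : E m) (v : Stack n m) : ‖diagInv y v.snd‖ ≤ ‖scale y v‖ :=
  norm_le_stack_right _ _

lemma norm_snd_le_scale {y : E m} (hy : ∀ i, 0 < y i) (v : Stack n m) :
    ‖v.snd‖ ≤ ‖y‖ * ‖scale y v‖ := by
  conv_lhs => rw [← diagMul_diagInv hy v.snd]
  exact (norm_diagMul_le _ _).trans
    (mul_le_mul_of_nonneg_left (norm_diagInv_le_scale y v) (norm_nonneg _))

lemma eq_zero_of_scale_eq_zero {y : E m} (hy : ∀ i, 0 < y i) {v : Stack n m}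
    (h : ‖scale y v‖ = 0) : v = 0 := by
  have h1 : v.fst = 0 := norm_le_zero_iff.1 (h ▸ norm_fst_le_scale y v)
  have h2 : v.snd = 0 := norm_le_zero_iff.1 (by simpa [h] using norm_snd_le_scale hy v)
  calc v = stack v.fst v.snd := rfl
    _ = 0 := by rw [h1, h2]; rfl

lemma norm_conJac (g : E n → E m) (x : E n) : ‖conJac g x‖ = ‖conGrad g x‖ :=
  (LinearIsometryEquiv.norm_map ContinuousLinearMap.adjoint _).symm

/-- `(Aᵀ I) = (Aᵀ Y) D`, so bounds on `A` and `y` control the linearized constraint by the scaled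
norm. -/
lemma norm_linearization_le {g : E n → E m} {s : State n m} (hy : ∀ i, 0 < s.y i) {a b : ℝ}
    (ha : ‖conGrad g s.x‖ ≤ a) (hb : ‖s.y‖ ≤ b) (v : Stack n m) :
    ‖conJac g s.x v.fst + v.snd‖ ≤ (a + b) * ‖scale s.y v‖ := by
  have h1 := (conJac g s.x).le_opNorm v.fst
  rw [norm_conJac] at h1
  have h2 := norm_snd_le_scale hy v
  have h3 : ‖conGrad g s.x‖ * ‖v.fst‖ ≤ a * ‖scale s.y v‖ :=
    mul_le_mul ha (norm_fst_le_scale _ _) (norm_nonneg _) ((norm_nonneg _).trans ha)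
  have h4 : ‖s.y‖ * ‖scale s.y v‖ ≤ b * ‖scale s.y v‖ :=
    mul_le_mul_of_nonneg_right hb (norm_nonneg _)
  linarith [norm_add_le (conJac g s.x v.fst) v.snd]

/-! ### Predicted reductions -/

lemma sigmaT_pos (P : Params) {s : State n m} (hσ : 0 < s.σ) : 0 < sigmaT P s :=
  div_pos hσ (pow_pos P.ξ_pos 3)

lemma le_sigmaT (P : Params) {s : State n m} (hσ : 0 < s.σ) : s.σ ≤ sigmaT P s := by
  rw [sigmaT, le_div_iff₀ (pow_pos P.ξ_pos 3)]
  exact mul_le_of_le_one_right hσ.le (pow_le_one₀ P.ξ_pos.le P.ξ_lt.le)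

@[simp] lemma npred_zero (g : E n → E m) (P : Params) (s : State n m) : npred g P s 0 = 0 := by
  simp [npred]

@[simp] lemma tpred_zero (f : E n → ℝ) (P : Params) (s : State n m) (v : Stack n m) :
    tpred f P s v 0 = 0 := by
  simp [tpred]

/-- The exact minimizer along the Cauchy direction does at least as well as any feasible step size,
so it never has to be computed: a convenient `α` suffices. -/
lemma IsNormalStep.npred_ge {g : E n → E m} {P : Params} {s : State n m} {v : Stack n m}
    (h : IsNormalStep g P s v) {α : ℝ} (hα : 0 ≤ α)
    (hf : NormalFeasible P s (α • normalDir g s)) :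
    P.γn * npred g P s (α • normalDir g s) ≤ npred g P s v := by
  obtain ⟨β, -, hβ, hle⟩ := h.cauchy
  have := hβ (show α ∈ {α : ℝ | 0 ≤ α ∧ NormalFeasible P s (α • normalDir g s)} from ⟨hα, hf⟩)
  simp only [Set.mem_ofPred_eq, neg_le_neg_iff] at this
  exact (mul_le_mul_of_nonneg_left this P.γn_pos.le).trans hle

lemma IsNormalStep.npred_nonneg {g : E n → E m} {P : Params} {s : State n m} {v : Stack n m}
    (h : IsNormalStep g P s v) (hy : ∀ i, 0 < s.y i) : 0 ≤ npred g P s v := by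
  have hf : NormalFeasible P s ((0 : ℝ) • normalDir g s) := fun i => by
    simpa using (mul_pos (mul_pos P.ξ_pos P.τ_pos) (hy i)).le
  simpa using h.npred_ge le_rfl hf

lemma IsTangentStep.tpred_nonneg {f : E n → ℝ} {g : E n → E m} {P : Params} {s : State n m}
    {v t : Stack n m} (hn : IsNormalStep g P s v) (h : IsTangentStep f g P s v t)
    (hy : ∀ i, 0 < s.y i) : 0 ≤ tpred f P s v t := by
  obtain ⟨β, -, hβ, hle⟩ := h.cauchy
  have hz : (0 : ℝ) ∈
      {β : ℝ | 0 ≤ β ∧ FractionToBoundary P s v (β • s.N (tangentDir f P s v))} := by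
    refine ⟨le_rfl, fun i => ?_⟩
    have h1 := hn.feasible i
    have h2 : P.ξ * P.τ * s.y i ≤ P.τ * s.y i := by
      have := mul_pos P.τ_pos (hy i)
      nlinarith [P.ξ_lt]
    simp only [zero_smul, WithLp.zero_snd, PiLp.zero_apply, add_zero]
    linarith
  have := hβ hz
  simp only [Set.mem_ofPred_eq, neg_le_neg_iff, zero_smul, tpred_zero] at this
  exact (mul_nonneg P.γt_pos.le this).trans hle

/-- The tangential step leaves the linearized residual unchanged, and the cross terms between `v`
and `t` are exactly those built into `tpred`; symmetry of `B` merges the two mixed products. -/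
lemma pred_eq {f : E n → ℝ} {g : E n → E m} {P : Params} {s : State n m} {v t : Stack n m}
    (hB : ∀ u v, inner ℝ (s.B u) v = inner ℝ u (s.B v))
    (ht : conJac g s.x t.fst + t.snd = 0) (ν : ℝ) :
    pred f g P s ν (v + t) =
      tpred f P s v t + 1 / 3 * s.σ * (‖scale s.y t‖ ^ 3 - ‖scale s.y (v + t)‖ ^ 3) + chi f P s v
        + ν * (npred g P s v + 1 / 3 * sigmaT P s * ‖scale s.y v‖ ^ 3) := by
  have hc : resid g s.x s.y + conJac g s.x (v.fst + t.fst) + (v.snd + t.snd)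
      = resid g s.x s.y + conJac g s.x v.fst + v.snd := by
    rw [map_add]
    calc _ = resid g s.x s.y + conJac g s.x v.fst + v.snd + (conJac g s.x t.fst + t.snd) := by
          abel
      _ = _ := by rw [ht, add_zero]
  have hsq : ‖diagInv s.y v.snd + diagInv s.y t.snd‖ ^ 2 = ‖diagInv s.y v.snd‖ ^ 2
      + 2 * inner ℝ (diagInv s.y v.snd) (diagInv s.y t.snd) + ‖diagInv s.y t.snd‖ ^ 2 :=
    norm_add_sq_real _ _
  have hvt : inner ℝ v.fst (s.B t.fst) = inner ℝ (s.B v.fst) t.fst := (hB _ _).symm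
  have htv : inner ℝ t.fst (s.B v.fst) = inner ℝ (s.B v.fst) t.fst := real_inner_comm _ _
  simp only [pred, model, tpred, chi, npred, WithLp.add_fst, WithLp.add_snd, WithLp.zero_fst,
    WithLp.zero_snd, hc, diagInv_add, hsq, map_add s.B, inner_add_left, inner_add_right, map_zero,
    inner_zero_right, diagInv_zero, scale_zero, norm_zero, add_zero, hvt, htv]
  ring

/-- For `d = 0` the quotient is `0` and the bound on `ν` carries no information; `h0` covers that
case. -/
lemma mul_add_nonneg_of_neg_div_le {a d ν : ℝ} (hd : 0 ≤ d) (h0 : d = 0 → 0 ≤ a)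
    (h : -(a / d) ≤ ν) : 0 ≤ a + ν * d := by
  rcases hd.eq_or_lt with hd | hd
  · rw [← hd]; simpa using h0 hd.symm
  · rw [← neg_div, div_le_iff₀ hd] at h
    linarith

/-- The penalty update makes the predicted reduction a fraction of the normal one. -/
lemma mul_npred_le_pred {f : E n → ℝ} {g : E n → E m} {P : Params} {s : State n m}
    {v t : Stack n m} (hy : ∀ i, 0 < s.y i) (hσ : 0 < s.σ)
    (hB : ∀ u v, inner ℝ (s.B u) v = inner ℝ u (s.B v))
    (hn : IsNormalStep g P s v) (ht : IsTangentStep f g P s v t) {ν : ℝ}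
    (hν : nuT f g P s v t ≤ ν) : P.δ * ν * npred g P s v ≤ pred f g P s ν (v + t) := by
  have hnp := hn.npred_nonneg hy
  have hs := sigmaT_pos P hσ
  have hδ : 0 < 1 - P.δ := by linarith [P.δ_lt]
  have h3 : 0 ≤ 1 / 3 * sigmaT P s * ‖scale s.y v‖ ^ 3 := by positivity
  have h4 : 0 ≤ (1 - P.δ) * npred g P s v := by positivity
  have key := mul_add_nonneg_of_neg_div_le (add_nonneg h4 h3) (fun h0 => ?_)
    ((le_max_left _ _).trans hν)
  · rw [pred_eq hB ht.null_space]
    linarith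
  -- Vanishing denominator: both summands are nonnegative, so the normal step is zero; then the
  -- cubic difference and `chi` vanish and the numerator is `tpred ≥ 0`.
  · have h5 : 1 / 3 * sigmaT P s * ‖scale s.y v‖ ^ 3 = 0 := by linarith
    have h6 : ‖scale s.y v‖ = 0 := by
      have : 1 / 3 * sigmaT P s ≠ 0 := by positivity
      simpa [hs.ne'] using h5
    have hv := eq_zero_of_scale_eq_zero hy h6
    have htp := ht.tpred_nonneg hn hy
    subst hv
    simpa [chi] using htp

/-- Lets one small constant meet finitely many smallness requirements: intersect the events and pick
a point. -/
lemma eventually_mul_le (A : ℝ) {B : ℝ} (hB : 0 < B) : ∀ᶠ θ in 𝓝[>] (0 : ℝ), θ * A ≤ B := by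
  have h : Tendsto (fun θ : ℝ => θ * A) (𝓝[>] 0) (𝓝 0) := by
    simpa using ((continuous_id.mul continuous_const).tendsto (0 : ℝ)).mono_left
      (nhdsWithin_le_nhds (s := Set.Ioi 0)) (f := fun θ : ℝ => θ * A)
  exact (h.eventually (gt_mem_nhds hB)).mono fun _ h => h.le

/-- The vector `(A; Y) c` with `c = g(x) + y`. -/
noncomputable def residGrad (g : E n → E m) (x : E n) (y : E m) : Stack n m :=
  stack (conGrad g x (resid g x y)) (diagMul y (resid g x y))

/-- Scaling turns `(A; Y²) c` into `(A; Y) c`; this is why `residGrad` is the measure of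
stationarity. -/
lemma scale_normalDir {g : E n → E m} {s : State n m} (hy : ∀ i, 0 < s.y i) :
    scale s.y (normalDir g s) = -residGrad g s.x s.y := by
  have : normalDir g s = (-1 : ℝ) • rangeVec g s (resid g s.x s.y) := by simp [normalDir]
  rw [this, scale_smul, neg_one_smul]
  simp [scale, rangeVec, residGrad, diagInv_diagMul hy]

lemma norm_residGrad_le {g : E n → E m} {x : E n} {y : E m} {a b C : ℝ}
    (ha : ‖conGrad g x‖ ≤ a) (hb : ‖y‖ ≤ b) (hC : ‖resid g x y‖ ≤ C) :
    ‖residGrad g x y‖ ≤ (a + b) * C := by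
  have h1 : ‖conGrad g x (resid g x y)‖ ≤ a * C :=
    ((conGrad g x).le_opNorm _).trans
      (mul_le_mul ha hC (norm_nonneg _) ((norm_nonneg _).trans ha))
  have h2 : ‖diagMul y (resid g x y)‖ ≤ b * C :=
    (norm_diagMul_le _ _).trans (mul_le_mul hb hC (norm_nonneg _) ((norm_nonneg _).trans hb))
  have h3 := norm_stack_le (conGrad g x (resid g x y)) (diagMul y (resid g x y))
  unfold residGrad
  linarith

/-- Decrease of the linearized residual along the steepest descent direction. -/
lemma residual_decrease {g : E n → E m} {s : State n m} (hy : ∀ i, 0 < s.y i) {a b C α : ℝ}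
    (ha : ‖conGrad g s.x‖ ≤ a) (hb : ‖s.y‖ ≤ b) (hC : ‖resid g s.x s.y‖ ≤ C) (hC0 : 0 < C)
    (hα : 0 ≤ α) (hα1 : α * (a + b) ^ 2 ≤ 1) :
    α * ‖residGrad g s.x s.y‖ ^ 2 / (2 * C) ≤ ‖resid g s.x s.y‖
      - ‖resid g s.x s.y + conJac g s.x (α • normalDir g s).fst + (α • normalDir g s).snd‖ := by
  set c := resid g s.x s.y with hc
  set w := residGrad g s.x s.y with hw
  set M := conJac g s.x (normalDir g s).fst + (normalDir g s).snd with hM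
  have h1 : c + conJac g s.x (α • normalDir g s).fst + (α • normalDir g s).snd = c + α • M := by
    simp only [WithLp.smul_fst, WithLp.smul_snd, map_smul, hM, smul_add, add_assoc]
  -- `M = -(Aᵀ A + Y²) c`, so pairing with `c` produces `-‖A c‖² - ‖Y c‖²`.
  have h2 : inner ℝ c M = -‖w‖ ^ 2 := by
    have e1 : (normalDir g s).fst = -conGrad g s.x c := rfl
    have e2 : (normalDir g s).snd = -diagMul s.y (diagMul s.y c) := rfl
    have e3 : inner ℝ c (conJac g s.x (conGrad g s.x c)) = ‖conGrad g s.x c‖ ^ 2 := by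
      rw [← ContinuousLinearMap.adjoint_inner_left, ← real_inner_self_eq_norm_sq]; rfl
    rw [hM, e1, e2, map_neg, inner_add_right, inner_neg_right, inner_neg_right, e3, inner_diagMul,
      real_inner_self_eq_norm_sq, hw, residGrad, norm_sq_stack]
    ring
  have h3 : ‖M‖ ≤ (a + b) * ‖w‖ := by
    have := norm_linearization_le hy ha hb (normalDir g s)
    rwa [scale_normalDir hy, norm_neg] at this
  have h4 : ‖c + α • M‖ ^ 2 = ‖c‖ ^ 2 - 2 * α * ‖w‖ ^ 2 + α ^ 2 * ‖M‖ ^ 2 := by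
    rw [norm_add_sq_real, inner_smul_right, h2, norm_smul, mul_pow, Real.norm_eq_abs, sq_abs]
    ring
  have h5 : ‖M‖ ^ 2 ≤ (a + b) ^ 2 * ‖w‖ ^ 2 := by
    rw [← mul_pow]; exact pow_le_pow_left₀ (norm_nonneg _) h3 2
  have h6 : α ^ 2 * ‖M‖ ^ 2 ≤ α * ‖w‖ ^ 2 := by
    calc α ^ 2 * ‖M‖ ^ 2 ≤ α ^ 2 * ((a + b) ^ 2 * ‖w‖ ^ 2) := by gcongr
      _ = (α * (a + b) ^ 2) * (α * ‖w‖ ^ 2) := by ring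
      _ ≤ 1 * (α * ‖w‖ ^ 2) := by gcongr
      _ = _ := one_mul _
  have h7 : ‖c + α • M‖ ^ 2 ≤ ‖c‖ ^ 2 - α * ‖w‖ ^ 2 := by linarith
  have h8 : 0 ≤ α * ‖w‖ ^ 2 := by positivity
  have h9 : ‖c + α • M‖ ≤ ‖c‖ := le_of_sq_le_sq (by linarith) (norm_nonneg _)
  -- The drop in norm is the drop in squares divided by the sum of the two norms, which is at most
  -- `2 C`.
  rw [h1, div_le_iff₀ (by positivity)]
  nlinarith

/-- Lower bound on the normal predicted reduction. -/
lemma exists_mul_le_npred (P : Params) {a b C ε : ℝ} (ha0 : 0 < a) (hb0 : 0 < b) (hC0 : 0 < C)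
    (hε : 0 < ε) : ∃ κ > 0, ∀ (g : E n → E m) (s : State n m) (v : Stack n m),
      (∀ i, 0 < s.y i) → 0 < s.σ → IsNormalStep g P s v → ‖conGrad g s.x‖ ≤ a → ‖s.y‖ ≤ b →
      ‖resid g s.x s.y‖ ≤ C → ε ≤ ‖residGrad g s.x s.y‖ → ∀ r, 0 < r → r ≤ 1 → s.σ * r ^ 2 ≤ 1 →
      κ * r ≤ npred g P s v := by
  have hξ := P.ξ_pos
  have hτ := P.τ_pos
  set W := (a + b) * C with hW
  have hW0 : 0 < W := by positivity
  -- The trial step size is `θ r`. The bound by `ξ τ` gives feasibility, the one with `(a + b)²` the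
  -- decrease of the residual, and `θ ≤ 1` with the last one keeps the cubic term below half of that
  -- decrease.
  obtain ⟨θ, ⟨⟨⟨h1, h2⟩, h3⟩, h4⟩, hθ⟩ := (((((eventually_mul_le 1 one_pos).and
    (eventually_mul_le W (mul_pos hξ hτ))).and (eventually_mul_le ((a + b) ^ 2) one_pos)).and
    (eventually_mul_le (4 * C * W) (pow_pos hξ 3))).and self_mem_nhdsWithin).exists
  replace hθ : 0 < θ := hθ
  rw [mul_one] at h1
  refine ⟨P.γn * (θ * ε ^ 2 / (4 * C)), by have := P.γn_pos; positivity, ?_⟩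
  intro g s v hy hσ hN ha hb hC hw r hr hr1 hσr
  have hwW : ‖residGrad g s.x s.y‖ ≤ W := norm_residGrad_le ha hb hC
  have hdec := residual_decrease hy ha hb hC hC0 (α := θ * r) (by positivity)
    (by
      have := mul_le_of_le_one_right (mul_nonneg hθ.le (sq_nonneg (a + b))) hr1
      linarith)
  have hθr : θ * r ≤ θ := mul_le_of_le_one_right hθ.le hr1
  have hfeas : NormalFeasible P s ((θ * r) • normalDir g s) := by
    intro i
    -- Each component of `Y² c` contains the factor `y i`, so feasibility reduces to `θ r (Y c)_i ≤
    -- ξ τ`, however small `y i` is.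
    have e2 : ((θ * r) • normalDir g s).snd i
        = -(θ * r * (s.y i * diagMul s.y (resid g s.x s.y) i)) := by
      simp [normalDir, rangeVec]
    have e3 : diagMul s.y (resid g s.x s.y) i ≤ W :=
      (le_abs_self _).trans ((abs_apply_le_norm _ i).trans ((norm_le_stack_right _ _).trans hwW))
    have e4 : θ * r * diagMul s.y (resid g s.x s.y) i ≤ P.ξ * P.τ :=
      calc θ * r * diagMul s.y (resid g s.x s.y) i ≤ θ * r * W := by gcongr
        _ ≤ θ * W := by gcongr
        _ ≤ _ := h2
    rw [e2]
    nlinarith [hy i]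
  refine le_trans ?_ (hN.npred_ge (by positivity) hfeas)
  rw [mul_assoc]
  refine mul_le_mul_of_nonneg_left ?_ P.γn_pos.le
  rw [npred, scale_smul, scale_normalDir hy, norm_smul, norm_neg,
    Real.norm_of_nonneg (by positivity)]
  set ω := ‖residGrad g s.x s.y‖ with hω
  have hω0 : 0 < ω := hε.trans_le hw
  have hcub : 1 / 3 * sigmaT P s * (θ * r * ω) ^ 3 ≤ θ * r * ω ^ 2 / (4 * C) := by
    have e1 : θ * (4 * C * ω) ≤ P.ξ ^ 3 := le_trans (by gcongr) h4
    have e2 : s.σ * r ^ 2 * (θ * (θ * (4 * C * ω))) ≤ 1 * (1 * P.ξ ^ 3) := by gcongr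
    rw [sigmaT, le_div_iff₀ (by positivity)]
    have : 1 / 3 * (s.σ / P.ξ ^ 3) * (θ * r * ω) ^ 3 * (4 * C)
        = 1 / 3 * (s.σ * r ^ 2 * (θ * (θ * (4 * C * ω))) / P.ξ ^ 3) * (θ * r * ω ^ 2) := by
      field_simp
    rw [this]
    have e3 : s.σ * r ^ 2 * (θ * (θ * (4 * C * ω))) / P.ξ ^ 3 ≤ 1 := by
      rw [div_le_one (by positivity)]; linarith
    have e4 : 0 < θ * r * ω ^ 2 := by positivity
    nlinarith
  have hlow : θ * ε ^ 2 / (4 * C) * r ≤ θ * r * ω ^ 2 / (4 * C) := by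
    rw [div_mul_eq_mul_div]
    have : ε ^ 2 ≤ ω ^ 2 := by gcongr
    gcongr ?_ / _
    nlinarith [mul_pos hθ hr]
  have hhalf : θ * r * ω ^ 2 / (2 * C) = θ * r * ω ^ 2 / (4 * C) + θ * r * ω ^ 2 / (4 * C) := by
    field_simp; norm_num
  linarith

/-! ### Bounds on the steps -/

/-- Both steps are `O(σ^{-1/2})`. -/
lemma exists_scale_step_le (P : Params) {a b G β : ℝ} (ha0 : 0 < a) (hb0 : 0 < b) (hG0 : 0 < G)
    (hβ0 : 0 < β) : ∃ C > 0, ∀ (f : E n → ℝ) (g : E n → E m) (s : State n m) (v t : Stack n m),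
      (∀ i, 0 < s.y i) → 0 < s.σ → IsNormalStep g P s v → IsTangentStep f g P s v t →
      ‖conGrad g s.x‖ ≤ a → ‖s.y‖ ≤ b → ‖gradient f s.x‖ ≤ G → ‖s.B‖ ≤ β →
      ∀ r, 0 < r → r ≤ 1 → s.σ * r ^ 2 = 1 → ‖scale s.y (v + t)‖ ≤ C * r := by
  have hμ := P.μ_pos
  set q := 3 * (a + b) + 1 with hq
  set C₁ := 3 * (G + β * q + β + P.μ * (‖ones m‖ + q)) with hC₁
  have hC₁0 : 0 < C₁ := by positivity
  refine ⟨q + (C₁ + 1), by positivity, ?_⟩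
  intro f g s v t hy hσ hn ht ha hb hG hB r hr hr1 hσr
  rw [scale_add]
  have hu0 := norm_nonneg (scale s.y v)
  have hz0 := norm_nonneg (scale s.y t)
  -- Divide by `z` and use `σ = r⁻²`; `max K 0` also covers `z = 0`, where `K` may have any sign.
  have hcancel : ∀ {z K : ℝ}, 0 ≤ z → s.σ * z ^ 3 ≤ K * z → z ^ 2 ≤ max K 0 * r ^ 2 := by
    intro z K hz h
    rcases hz.eq_or_lt with rfl | hz
    · simpa using mul_nonneg (le_max_right K 0) (sq_nonneg r)
    · have h1 : s.σ * z ^ 2 ≤ K := by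
        refine le_of_mul_le_mul_right ?_ hz
        linarith
      calc z ^ 2 = s.σ * z ^ 2 * r ^ 2 := by linear_combination -(z ^ 2) * hσr
        _ ≤ K * r ^ 2 := by gcongr
        _ ≤ _ := by gcongr; exact le_max_left _ _
  -- `npred ≥ 0` bounds the cubic term by the drop of the linearized residual, which is linear in
  -- the step. The same argument with `tpred ≥ 0` bounds the tangential step, with an additional
  -- quadratic term.
  have hnr : ‖scale s.y v‖ ≤ q * r := by
    have h1 := hn.npred_nonneg hy
    have h2 : ‖resid g s.x s.y‖ - ‖resid g s.x s.y + conJac g s.x v.fst + v.snd‖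
        ≤ (a + b) * ‖scale s.y v‖ := by
      refine le_trans ?_ (norm_linearization_le hy ha hb v)
      have := norm_sub_norm_le (resid g s.x s.y)
        (resid g s.x s.y + conJac g s.x v.fst + v.snd)
      rwa [show resid g s.x s.y - (resid g s.x s.y + conJac g s.x v.fst + v.snd)
        = -(conJac g s.x v.fst + v.snd) by abel, norm_neg] at this
    have h3 : s.σ * ‖scale s.y v‖ ^ 3 ≤ sigmaT P s * ‖scale s.y v‖ ^ 3 := by
      gcongr; exact le_sigmaT P hσ
    rw [npred] at h1
    have h4 := hcancel hu0 (K := 3 * (a + b)) (by linarith)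
    rw [max_eq_left (by positivity)] at h4
    refine le_of_sq_le_sq (h4.trans ?_) (by positivity)
    rw [mul_pow]
    gcongr
    nlinarith
  have hnq : ‖scale s.y v‖ ≤ q := hnr.trans (mul_le_of_le_one_right (by positivity) hr1)
  have htr : ‖scale s.y t‖ ≤ (C₁ + 1) * r := by
    have h1 := ht.tpred_nonneg hn hy
    set z := ‖scale s.y t‖ with hz
    have hBv : ∀ u : E n, ‖s.B u‖ ≤ β * ‖u‖ := fun u => (s.B.le_opNorm u).trans (by gcongr)
    have i1 : -inner ℝ (gradient f s.x + s.B v.fst) t.fst ≤ (G + β * q) * z := by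
      refine (neg_le_abs _).trans ((abs_real_inner_le_norm _ _).trans ?_)
      have e1 : ‖gradient f s.x + s.B v.fst‖ ≤ G + β * q := by
        refine (norm_add_le _ _).trans (add_le_add hG ((hBv _).trans ?_))
        gcongr
        exact (norm_fst_le_scale _ _).trans hnq
      exact mul_le_mul e1 (norm_fst_le_scale _ _) (norm_nonneg _) (by positivity)
    have i2 : -(1 / 2 * inner ℝ t.fst (s.B t.fst)) ≤ β * z ^ 2 := by
      have e1 : -inner ℝ t.fst (s.B t.fst) ≤ z * (β * z) := by
        refine (neg_le_abs _).trans ((abs_real_inner_le_norm _ _).trans ?_)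
        have e2 := norm_fst_le_scale s.y t
        exact mul_le_mul e2 ((hBv _).trans (by gcongr)) (norm_nonneg _) hz0
      have : 0 ≤ β * z ^ 2 := by positivity
      nlinarith
    have i3 : inner ℝ (ones m) (diagInv s.y t.snd) ≤ ‖ones m‖ * z :=
      (real_inner_le_norm _ _).trans (by gcongr; exact norm_diagInv_le_scale _ _)
    have i4 : -inner ℝ (diagInv s.y v.snd) (diagInv s.y t.snd) ≤ q * z := by
      refine (neg_le_abs _).trans ((abs_real_inner_le_norm _ _).trans ?_)
      exact mul_le_mul ((norm_diagInv_le_scale _ _).trans hnq) (norm_diagInv_le_scale _ _)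
        (norm_nonneg _) (by positivity)
    have i5 : P.μ * (inner ℝ (ones m) (diagInv s.y t.snd)
        - inner ℝ (diagInv s.y v.snd) (diagInv s.y t.snd)
        - 1 / 2 * ‖diagInv s.y t.snd‖ ^ 2) ≤ P.μ * ((‖ones m‖ + q) * z) := by
      gcongr
      nlinarith [sq_nonneg ‖diagInv s.y t.snd‖]
    rw [tpred] at h1
    have h2 : s.σ * z ^ 3 ≤ C₁ * (1 + z) * z := by
      have e1 : 0 ≤ (G + β * q + P.μ * (‖ones m‖ + q)) * z ^ 2 := by positivity
      have e2 : 0 ≤ β * z := by positivity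
      have e3 : C₁ * (1 + z) * z = 3 * ((G + β * q) * z + β * z ^ 2 + P.μ * ((‖ones m‖ + q) * z))
          + 3 * ((G + β * q + P.μ * (‖ones m‖ + q)) * z ^ 2) + 3 * (β * z) := by
        rw [hC₁]; ring
      linarith
    have h3 := hcancel hz0 h2
    rw [max_eq_left (by positivity)] at h3
    -- Here `z² ≤ C₁ r² + C₁ z r²`, and `r ≤ 1` bounds this by `C₁ r² + C₁ z r`; `z > (C₁ + 1) r`
    -- would give `z² > C₁ z r + z r > C₁ z r + C₁ r²`.
    by_contra! hlt
    have hz1 : 0 < z := lt_trans (by positivity) hlt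
    have h4 : C₁ * z * r ^ 2 ≤ C₁ * z * r := by
      gcongr
      rw [sq]
      exact mul_le_of_le_one_right hr.le hr1
    have h5 := mul_lt_mul_of_pos_right hlt hz1
    have h6 := mul_lt_mul_of_pos_right hlt hr
    have h7 := mul_pos hr hr
    linarith
  calc ‖scale s.y v + scale s.y t‖ ≤ q * r + (C₁ + 1) * r :=
        (norm_add_le _ _).trans (add_le_add hnr htr)
    _ = _ := by ring

/-! ### Actual versus predicted reduction -/

/-- With `s = d / y`, `log (1 + s) ≥ 1 - 1 / (1 + s) = s - s² / (1 + s)`, and the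
fraction-to-boundary rule keeps `1 + s ≥ 1 - τ`. -/
lemma neg_sq_div_le_log_sub {τ y d : ℝ} (hτ : τ < 1) (hy : 0 < y) (hd : -τ * y ≤ d) :
    -((d / y) ^ 2 / (1 - τ)) ≤ Real.log (y + d) - Real.log y - d / y := by
  have h1 : 0 < 1 - τ := by linarith
  have hs : -τ ≤ d / y := by rwa [le_div_iff₀ hy]
  have h2 : y + d = y * (1 + d / y) := by field_simp
  set s := d / y
  have h3 : 0 < 1 + s := by linarith
  rw [h2, Real.log_mul hy.ne' h3.ne']
  have h4 := Real.one_sub_inv_le_log_of_pos h3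
  have h5 : 1 - (1 + s)⁻¹ = s - s ^ 2 / (1 + s) := by field_simp; ring
  have h6 : s ^ 2 / (1 + s) ≤ s ^ 2 / (1 - τ) := by gcongr; linarith
  linarith

lemma neg_norm_sq_div_le_sum_log {τ : ℝ} (hτ : τ < 1) {y d : E m} (hy : ∀ i, 0 < y i)
    (hd : ∀ i, -τ * y i ≤ d i) : -(‖diagInv y d‖ ^ 2 / (1 - τ)) ≤
      ∑ i, Real.log ((y + d) i) - ∑ i, Real.log (y i) - inner ℝ (ones m) (diagInv y d) := by
  have h1 : inner ℝ (ones m) (diagInv y d) = ∑ i, d i / y i := by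
    simp [PiLp.inner_apply]
  rw [h1, EuclideanSpace.real_norm_sq_eq, Finset.sum_div, ← Finset.sum_neg_distrib,
    ← Finset.sum_sub_distrib, ← Finset.sum_sub_distrib]
  exact Finset.sum_le_sum fun i _ => neg_sq_div_le_log_sub hτ (hy i) (hd i)

/-- Only a lower bound on the actual reduction is needed, so the cubic and quadratic barrier terms
of the model, which merely lower `pred`, are dropped. The linearization errors of `f` and `g` enter
with weights `1` and `ν`; the rest is quadratic. -/
lemma pred_sub_le_ared {f : E n → ℝ} {g : E n → E m} {P : Params} {s : State n m} {d : Stack n m}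
    {ν κ β : ℝ} (hy : ∀ i, 0 < s.y i) (hσ : 0 < s.σ) (hν : 0 ≤ ν) (hκ : 0 ≤ κ)
    (hd : ∀ i, -P.τ * s.y i ≤ d.snd i) (hB : ‖s.B‖ ≤ β)
    (hf : |f (s.x + d.fst) - f s.x - inner ℝ (gradient f s.x) d.fst| ≤ κ * ‖d.fst‖)
    (hg : ‖g (s.x + d.fst) - g s.x - conJac g s.x d.fst‖ ≤ κ * ‖d.fst‖) :
    pred f g P s ν d - (κ * (1 + ν) * ‖scale s.y d‖
      + (β + P.μ / (1 - P.τ)) * ‖scale s.y d‖ ^ 2) ≤ ared f g P s ν d := by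
  have hτ : 0 < 1 - P.τ := by linarith [P.τ_lt]
  have hμ := P.μ_pos
  set z := ‖scale s.y d‖
  have hx : ‖d.fst‖ ≤ z := norm_fst_le_scale _ _
  have hyz : ‖diagInv s.y d.snd‖ ≤ z := norm_diagInv_le_scale _ _
  have i1 := (abs_le.1 (hf.trans (mul_le_mul_of_nonneg_left hx hκ))).2
  have i2 : -(β * z ^ 2) ≤ 1 / 2 * inner ℝ d.fst (s.B d.fst) := by
    have e1 : -inner ℝ d.fst (s.B d.fst) ≤ z * (β * z) := by
      refine (neg_le_abs _).trans ((abs_real_inner_le_norm _ _).trans ?_)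
      refine mul_le_mul hx ((s.B.le_opNorm _).trans ?_) (norm_nonneg _) ((norm_nonneg _).trans hx)
      exact mul_le_mul hB hx (norm_nonneg _) ((norm_nonneg _).trans hB)
    have e2 : 0 ≤ β * z ^ 2 := mul_nonneg ((norm_nonneg _).trans hB) (sq_nonneg z)
    linarith
  have i3 := mul_le_mul_of_nonneg_left (neg_norm_sq_div_le_sum_log P.τ_lt hy hd) hμ.le
  have i4 : P.μ * (‖diagInv s.y d.snd‖ ^ 2 / (1 - P.τ)) ≤ P.μ / (1 - P.τ) * z ^ 2 := by
    rw [div_mul_eq_mul_div, mul_div_assoc]; gcongr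
  have i5 : ‖resid g (s.x + d.fst) (s.y + d.snd)‖ ≤
      ‖resid g s.x s.y + conJac g s.x d.fst + d.snd‖ + κ * z := by
    have e1 : resid g (s.x + d.fst) (s.y + d.snd) = (resid g s.x s.y + conJac g s.x d.fst + d.snd)
        + (g (s.x + d.fst) - g s.x - conJac g s.x d.fst) := by
      simp only [resid]; abel
    rw [e1]
    exact (norm_add_le _ _).trans (by gcongr; exact hg.trans (by gcongr))
  have i6 := mul_le_mul_of_nonneg_left i5 hν
  have i7 : 0 ≤ 1 / 3 * s.σ * z ^ 3 := by positivity
  have i8 : 0 ≤ P.μ * (1 / 2 * ‖diagInv s.y d.snd‖ ^ 2) := by positivity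
  have hm : model f g P s ν 0 = merit f g P.μ ν s.x s.y := by
    simp [model, merit]
  rw [pred, ared, hm]
  simp only [model, merit]
  linarith

/-- Strict differentiability at `x₀` controls the error with the derivative at `x₀`; continuity of
the derivative moves it to the base point `x`. The bound is uniform near `x₀` and needs nothing
about where the trial point `x + d` lies beyond its closeness to `x₀`. -/
lemma exists_linearization_error_le {V : Type*} [NormedAddCommGroup V] [NormedSpace ℝ V]
    {F : E n → V} (hF : ContDiff ℝ 1 F) (x₀ : E n) {κ : ℝ} (hκ : 0 < κ) :
    ∃ ρ > 0, ∀ x d : E n, ‖x - x₀‖ < ρ → ‖d‖ < ρ →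
      ‖F (x + d) - F x - fderiv ℝ F x d‖ ≤ κ * ‖d‖ := by
  have h1 := (hF.contDiffAt (x := x₀)).hasStrictFDerivAt one_ne_zero
  have h2 := h1.isLittleO.def (half_pos hκ)
  obtain ⟨ρ₁, hρ₁, h2⟩ := Metric.eventually_nhds_iff.1 h2
  have h3 := Metric.continuousAt_iff.1
    ((hF.continuous_fderiv one_ne_zero).continuousAt (x := x₀)) (κ / 2) (half_pos hκ)
  obtain ⟨ρ₂, hρ₂, h3⟩ := h3
  refine ⟨min (ρ₁ / 2) ρ₂, by positivity, fun x d hx hd => ?_⟩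
  have hx1 := hx.trans_le (min_le_left _ _)
  have hd1 := hd.trans_le (min_le_left _ _)
  have e1 : dist (x + d, x) (x₀, x₀) < ρ₁ := by
    rw [Prod.dist_eq, max_lt_iff, dist_eq_norm, dist_eq_norm]
    refine ⟨?_, by simp only; linarith⟩
    have : x + d - x₀ = (x - x₀) + d := by abel
    simp only [this]
    linarith [norm_add_le (x - x₀) d]
  have e2 := h2 e1
  simp only [add_sub_cancel_left] at e2
  have e3 : dist x x₀ < ρ₂ := by rw [dist_eq_norm]; exact hx.trans_le (min_le_right _ _)
  have e4 := (h3 e3).le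
  rw [dist_eq_norm] at e4
  have e5 : ‖(fderiv ℝ F x - fderiv ℝ F x₀) d‖ ≤ κ / 2 * ‖d‖ :=
    (ContinuousLinearMap.le_opNorm _ _).trans (by gcongr)
  have e6 : F (x + d) - F x - fderiv ℝ F x d
      = (F (x + d) - F x - fderiv ℝ F x₀ d) - (fderiv ℝ F x - fderiv ℝ F x₀) d := by
    simp
  rw [e6]
  calc _ ≤ κ / 2 * ‖d‖ + κ / 2 * ‖d‖ := (norm_sub_le _ _).trans (add_le_add e2 e5)
    _ = _ := by ring

/-! ### Elementary properties of a run -/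

section Run

variable {f : E n → ℝ} {g : E n → E m} {P : Params} {R : Run n m}

/-- The predicted reduction of the normal step in iteration `k`. -/
noncomputable def Run.npred (R : Run n m) (g : E n → E m) (P : Params) (k : ℕ) : ℝ :=
  ARCBIP.npred g P (R.st k) (R.nstep k)

/-- The vector `(A_k; Y_k)(g_k + y_k)`. -/
noncomputable def Run.residGrad (R : Run n m) (g : E n → E m) (k : ℕ) : Stack n m :=
  ARCBIP.residGrad g (R.st k).x (R.st k).y

lemma IsRun.step_boundary (hR : IsRun f g P R) (k : ℕ) (i : Fin m) :
    -P.τ * (R.st k).y i ≤ (R.step k).snd i :=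
  (hR.tangent k).boundary i

lemma IsRun.y_pos (hR : IsRun f g P R) (k : ℕ) : ∀ i, 0 < (R.st k).y i := by
  induction k with
  | zero => exact hR.y_init
  | succ k ih =>
    intro i
    rcases lt_or_ge (R.rho f g P k) P.η₁ with h | h
    · rw [(hR.reject k h).2]; exact ih i
    · rw [(hR.accept k h).2, PiLp.add_apply]
      have := hR.step_boundary k i
      nlinarith [ih i, P.τ_lt]

lemma le_nuUpdate_right (a b : ℝ) : b ≤ nuUpdate a b := by
  unfold nuUpdate; split_ifs with h
  · exact h
  · exact le_max_left _ _

lemma le_nuUpdate (a b : ℝ) : a ≤ nuUpdate a b := by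
  unfold nuUpdate; split_ifs with h
  · exact le_rfl
  · exact (not_le.1 h).le.trans (le_max_left _ _)

lemma IsRun.nuT_le (hR : IsRun f g P R) (k : ℕ) :
    nuT f g P (R.st k) (R.nstep k) (R.tstep k) ≤ R.ν k := by
  cases k with
  | zero => rw [hR.ν_zero]; exact le_nuUpdate_right _ _
  | succ k => rw [hR.ν_succ]; exact le_nuUpdate_right _ _

lemma IsRun.ν_le_succ (hR : IsRun f g P R) (k : ℕ) : R.ν k ≤ R.ν (k + 1) := by
  rw [hR.ν_succ]; exact le_nuUpdate _ _

lemma IsRun.νinit_le (hR : IsRun f g P R) (k : ℕ) : R.νinit ≤ R.ν k := by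
  induction k with
  | zero => rw [hR.ν_zero]; exact le_nuUpdate _ _
  | succ k ih => exact ih.trans (hR.ν_le_succ k)

lemma IsRun.npred_nonneg (hR : IsRun f g P R) (k : ℕ) : 0 ≤ R.npred g P k :=
  (hR.normal k).npred_nonneg (hR.y_pos k)

lemma IsRun.mul_npred_le_pred (hR : IsRun f g P R) (k : ℕ) :
    P.δ * R.ν k * R.npred g P k ≤ pred f g P (R.st k) (R.ν k) (R.step k) :=
  ARCBIP.mul_npred_le_pred (hR.y_pos k) (hR.σ_pos k) (hR.B_symm k) (hR.normal k) (hR.tangent k)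
    (hR.nuT_le k)

lemma IsRun.pred_nonneg (hR : IsRun f g P R) (k : ℕ) :
    0 ≤ pred f g P (R.st k) (R.ν k) (R.step k) := by
  have h1 := hR.ν_init.trans_le (hR.νinit_le k)
  have h2 := hR.npred_nonneg k
  have h3 := P.δ_pos
  exact le_trans (by positivity) (hR.mul_npred_le_pred k)

/-! ### A Lyapunov function -/

/-- The logarithms grow more slowly than any multiple of `‖y‖`, and `‖y‖ ≤ ‖c‖ + ‖g‖`, so an
arbitrarily small multiple of `‖c‖` compensates the barrier. -/
lemma exists_log_barrier_bound (P : Params) {h fmin Cg : ℝ} (hh : 0 < h) :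
    ∃ K : ℝ, ∀ (x : E n) (y : E m), (∀ i, 0 < y i) → fmin ≤ f x → ‖g x‖ ≤ Cg →
      0 ≤ f x - P.μ * ∑ i, Real.log (y i) + h * ‖resid g x y‖ + K := by
  have hμ := P.μ_pos
  -- The slope is chosen so that `μ m a ≤ h`; `m + 1` keeps it positive for `m = 0`.
  set a := h / (P.μ * (m + 1)) with ha
  have ha0 : 0 < a := by positivity
  refine ⟨-fmin + h * Cg - P.μ * (m * Real.log a), fun x y hy hf hg => ?_⟩
  have h1 : ∑ i, Real.log (y i) ≤ m * (a * ‖y‖ - Real.log a) := by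
    have : ∀ i ∈ Finset.univ, Real.log (y i) ≤ a * ‖y‖ - Real.log a := fun i _ => by
      have e1 := Real.log_le_sub_one_of_pos (mul_pos ha0 (hy i))
      rw [Real.log_mul ha0.ne' (hy i).ne'] at e1
      have e2 := mul_le_mul_of_nonneg_left ((le_abs_self _).trans (abs_apply_le_norm y i)) ha0.le
      linarith
    simpa using Finset.sum_le_card_nsmul _ _ _ this
  have h2 : ‖y‖ ≤ ‖resid g x y‖ + Cg := by
    have : y = resid g x y - g x := by simp [resid]
    calc ‖y‖ = ‖resid g x y - g x‖ := by rw [← this]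
      _ ≤ _ := (norm_sub_le _ _).trans (by gcongr)
  have h3 : P.μ * (m * (a * ‖y‖)) ≤ h * ‖y‖ := by
    have : P.μ * (m * a) ≤ h := by
      rw [ha]
      calc P.μ * (m * (h / (P.μ * (m + 1)))) = h * (m / (m + 1)) := by field_simp
        _ ≤ h * 1 := by gcongr; rw [div_le_one (by positivity)]; linarith
        _ = h := mul_one h
    nlinarith [norm_nonneg y]
  have h4 := mul_le_mul_of_nonneg_left h1 hμ.le
  have h5 := mul_le_mul_of_nonneg_left h2 hh.le
  linarith

/-- The function is `Ψ = F / (ν - h) + ‖c‖`, with `F = f - μ ∑ log y + h ‖c‖ + K ≥ 0`. Up to the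
constant `K`, the merit function is `F + (ν - h) ‖c‖`. Raising `ν` can only lower `Ψ` because `F ≥
0`, and dividing `pred ≥ δ ν npred` by `ν - h` leaves a decrease independent of `ν`. -/
lemma IsRun.exists_lyapunov (hR : IsRun f g P R) (hf : ∃ C : ℝ, ∀ k, C ≤ f (R.st k).x)
    (hg : ∃ C : ℝ, ∀ k, ‖g (R.st k).x‖ ≤ C) :
    ∃ Ψ : ℕ → ℝ, Antitone Ψ ∧ (∀ k, ‖resid g (R.st k).x (R.st k).y‖ ≤ Ψ k) ∧
      ∀ k, P.η₁ ≤ R.rho f g P k → P.η₁ * P.δ * R.npred g P k ≤ Ψ k - Ψ (k + 1) := by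
  obtain ⟨fmin, hf⟩ := hf
  obtain ⟨Cg, hg⟩ := hg
  set h := R.νinit / 2 with hh
  have hν0 := hR.ν_init
  have hh0 : 0 < h := by positivity
  obtain ⟨K, hK⟩ := exists_log_barrier_bound (f := f) (g := g) P (fmin := fmin) (Cg := Cg) hh0
  set F : ℕ → ℝ := fun k => f (R.st k).x - P.μ * ∑ i, Real.log ((R.st k).y i)
    + h * ‖resid g (R.st k).x (R.st k).y‖ + K with hF
  have hF0 : ∀ k, 0 ≤ F k := fun k => hK _ _ (hR.y_pos k) (hf k) (hg k)
  have hνh : ∀ k, 0 < R.ν k - h := fun k => by linarith [hR.νinit_le k]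
  set c : ℕ → ℝ := fun k => ‖resid g (R.st k).x (R.st k).y‖ with hc
  have hmono : ∀ k, F (k + 1) / (R.ν (k + 1) - h) ≤ F (k + 1) / (R.ν k - h) := fun k => by
    have := hνh k
    have := hR.ν_le_succ k
    have := hF0 (k + 1)
    gcongr
  have hacc : ∀ k, P.η₁ ≤ R.rho f g P k → P.η₁ * P.δ * R.npred g P k ≤
      (F k / (R.ν k - h) + c k) - (F (k + 1) / (R.ν (k + 1) - h) + c (k + 1)) := fun k hk => by
    have hp := hR.pred_nonneg k
    have hη := P.η₁_pos
    have hared : P.η₁ * pred f g P (R.st k) (R.ν k) (R.step k)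
        ≤ ared f g P (R.st k) (R.ν k) (R.step k) := by
      rcases hp.eq_or_lt with hp | hp
      -- A vanishing denominator means `ρ = 0`, which is not an accepted iteration.
      · rw [Run.rho, ratio, ← hp, div_zero] at hk
        linarith
      · rwa [Run.rho, ratio, le_div_iff₀ hp] at hk
    have hm : ared f g P (R.st k) (R.ν k) (R.step k)
        = (F k + (R.ν k - h) * c k) - (F (k + 1) + (R.ν k - h) * c (k + 1)) := by
      simp only [ared, ← (hR.accept k hk).1, ← (hR.accept k hk).2, merit, hF, hc]
      ring
    have h1 : P.η₁ * P.δ * R.npred g P k * (R.ν k - h)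
        ≤ P.η₁ * pred f g P (R.st k) (R.ν k) (R.step k) := by
      have e1 := mul_le_mul_of_nonneg_left (hR.mul_npred_le_pred k) hη.le
      have e2 : 0 ≤ P.η₁ * P.δ * R.npred g P k * h := by
        have := hR.npred_nonneg k
        have := P.δ_pos
        positivity
      linarith
    have h2 : P.η₁ * P.δ * R.npred g P k ≤
        (F k / (R.ν k - h) + c k) - (F (k + 1) / (R.ν k - h) + c (k + 1)) := by
      refine le_of_mul_le_mul_right ?_ (hνh k)
      have e1 := (hνh k).ne'
      have e2 : ((F k / (R.ν k - h) + c k) - (F (k + 1) / (R.ν k - h) + c (k + 1)))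
          * (R.ν k - h) = (F k + (R.ν k - h) * c k) - (F (k + 1) + (R.ν k - h) * c (k + 1)) := by
        field_simp
      rw [e2, ← hm]
      exact h1.trans hared
    linarith [hmono k]
  refine ⟨fun k => F k / (R.ν k - h) + c k, antitone_nat_of_succ_le fun k => ?_, fun k => ?_, hacc⟩
  · rcases lt_or_ge (R.rho f g P k) P.η₁ with hk | hk
    · have e1 : c (k + 1) = c k := by simp only [hc, (hR.reject k hk).1, (hR.reject k hk).2]
      have e2 : F (k + 1) = F k := by simp only [hF, (hR.reject k hk).1, (hR.reject k hk).2]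
      have := hmono k
      rw [e2] at this
      simp only [e1, e2]
      linarith
    · have h1 := hacc k hk
      have h2 : 0 ≤ P.η₁ * P.δ * R.npred g P k := by
        have := hR.npred_nonneg k
        have := P.δ_pos
        have := P.η₁_pos
        positivity
      linarith
  · have := div_nonneg (hF0 k) (hνh k).le
    simp only
    linarith

/-! ### Convergence -/

/-- Uniform bounds on the data along a run. -/
structure RunBounds (f : E n → ℝ) (g : E n → E m) (R : Run n m) (a b C G β : ℝ) : Prop where
  a_pos : 0 < a
  b_pos : 0 < b
  C_pos : 0 < C
  G_pos : 0 < G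
  β_pos : 0 < β
  conGrad_le : ∀ k, ‖conGrad g (R.st k).x‖ ≤ a
  y_le : ∀ k, ‖(R.st k).y‖ ≤ b
  resid_le : ∀ k, ‖resid g (R.st k).x (R.st k).y‖ ≤ C
  gradient_le : ∀ k, ‖gradient f (R.st k).x‖ ≤ G
  B_le : ∀ k, ‖(R.st k).B‖ ≤ β

lemma exists_runBounds (h2 : A2 f g R) {Ψ : ℕ → ℝ} (hΨ : Antitone Ψ)
    (hc : ∀ k, ‖resid g (R.st k).x (R.st k).y‖ ≤ Ψ k) :
    ∃ a b C G β, RunBounds f g R a b C G β := by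
  obtain ⟨-, ⟨G, hG⟩, ⟨Cg, hg⟩, ⟨a, ha⟩, ⟨β, hβ⟩⟩ := h2
  have hc0 : ∀ k, ‖resid g (R.st k).x (R.st k).y‖ ≤ Ψ 0 := fun k => (hc k).trans (hΨ k.zero_le)
  refine ⟨max a 1, max (Ψ 0 + Cg) 1, max (Ψ 0) 1, max G 1, max β 1, by positivity, by positivity,
    by positivity, by positivity, by positivity, fun k => (ha k).trans (le_max_left _ _),
    fun k => ?_, fun k => (hc0 k).trans (le_max_left _ _), fun k => (hG k).trans (le_max_left _ _),
    fun k => (hβ k).trans (le_max_left _ _)⟩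
  refine le_trans ?_ (le_max_left _ _)
  have : (R.st k).y = resid g (R.st k).x (R.st k).y - g (R.st k).x := by simp [resid]
  rw [this]
  exact (norm_sub_le _ _).trans (add_le_add (hc0 k) (hg k))

/-- The natural length is `r = σ^{-1/2}`; a lower bound on `σ` becomes an upper bound on `r`. -/
lemma exists_mul_sq_eq_one {σ σ₀ r₀ : ℝ} (hr₀ : 0 < r₀) (h : σ₀ * r₀ ^ 2 = 1) (hσ : σ₀ ≤ σ) :
    ∃ r, 0 < r ∧ r ≤ r₀ ∧ σ * r ^ 2 = 1 := by
  have h0 : 0 < σ₀ := pos_of_mul_pos_left (h ▸ one_pos) (sq_nonneg r₀)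
  have hσ0 : 0 < σ := h0.trans_le hσ
  refine ⟨(√σ)⁻¹, by positivity, ?_, ?_⟩
  · refine le_of_sq_le_sq ?_ hr₀.le
    rw [inv_pow, Real.sq_sqrt hσ0.le, inv_le_iff_one_le_mul₀ hσ0, ← h]
    nlinarith [sq_nonneg r₀]
  · rw [inv_pow, Real.sq_sqrt hσ0.le, mul_inv_cancel₀ hσ0.ne']

lemma tendsto_sub_succ {Ψ : ℕ → ℝ} (hΨ : Antitone Ψ) (h0 : ∀ k, 0 ≤ Ψ k) :
    Tendsto (fun k => Ψ k - Ψ (k + 1)) atTop (𝓝 0) := by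
  have h := tendsto_atTop_ciInf hΨ ⟨0, Set.forall_mem_range.2 h0⟩
  simpa using h.sub (h.comp (tendsto_add_atTop_nat 1))

/-- Late successful iterations away from stationarity have a large regularisation parameter. -/
lemma IsRun.eventually_lt_σ (hR : IsRun f g P R) {a b C G β : ℝ} (hb : RunBounds f g R a b C G β)
    {Ψ : ℕ → ℝ} (hlim : Tendsto (fun k => Ψ k - Ψ (k + 1)) atTop (𝓝 0))
    (hdec : ∀ k, P.η₁ ≤ R.rho f g P k → P.η₁ * P.δ * R.npred g P k ≤ Ψ k - Ψ (k + 1))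
    {ε : ℝ} (hε : 0 < ε) (S : ℝ) :
    ∀ᶠ k in atTop, P.η₁ ≤ R.rho f g P k → ε ≤ ‖R.residGrad g k‖ → S < (R.st k).σ := by
  obtain ⟨κ, hκ, hnp⟩ := exists_mul_le_npred (n := n) (m := m) P hb.a_pos hb.b_pos hb.C_pos hε
  have hη := P.η₁_pos
  have hδ := P.δ_pos
  -- One `r ≤ 1` serves all `σ ≤ S`: then `npred ≥ κ r` is a fixed positive amount, incompatible
  -- with the vanishing drops of `Ψ`.
  obtain ⟨r, hr, hr1, hSr⟩ := exists_mul_sq_eq_one one_pos (by norm_num : (1 : ℝ) * 1 ^ 2 = 1)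
    (le_max_right S 1)
  filter_upwards [hlim.eventually (gt_mem_nhds (show 0 < P.η₁ * P.δ * (κ * r) by positivity))]
    with k hk hacc hw
  by_contra! hS
  have h1 : (R.st k).σ * r ^ 2 ≤ 1 := by
    rw [← hSr]; gcongr; exact hS.trans (le_max_left _ _)
  have h2 : κ * r ≤ R.npred g P k := hnp g _ _ (hR.y_pos k) (hR.σ_pos k) (hR.normal k)
    (hb.conGrad_le k) (hb.y_le k) (hb.resid_le k) hw r hr hr1 h1
  have h3 := (mul_le_mul_of_nonneg_left h2 (mul_pos hη hδ).le).trans (hdec k hacc)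
  linarith

/-- Late successful steps away from stationarity are bounded by the decrease. -/
lemma IsRun.exists_step_le_npred (hR : IsRun f g P R) {a b C G β : ℝ}
    (hb : RunBounds f g R a b C G β) {Ψ : ℕ → ℝ}
    (hlim : Tendsto (fun k => Ψ k - Ψ (k + 1)) atTop (𝓝 0))
    (hdec : ∀ k, P.η₁ ≤ R.rho f g P k → P.η₁ * P.δ * R.npred g P k ≤ Ψ k - Ψ (k + 1))
    {ε : ℝ} (hε : 0 < ε) :
    ∃ D > 0, ∀ᶠ k in atTop, P.η₁ ≤ R.rho f g P k → ε ≤ ‖R.residGrad g k‖ →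
      ‖scale (R.st k).y (R.step k)‖ ≤ D * R.npred g P k := by
  obtain ⟨κ, hκ, hnp⟩ := exists_mul_le_npred (n := n) (m := m) P hb.a_pos hb.b_pos hb.C_pos hε
  obtain ⟨Cs, hCs, hst⟩ := exists_scale_step_le (n := n) (m := m) P hb.a_pos hb.b_pos hb.G_pos
    hb.β_pos
  refine ⟨Cs / κ, by positivity, ?_⟩
  -- Late on `σ > 1`, so `r = σ^{-1/2} ≤ 1` and both bounds apply; their quotient does not involve
  -- `σ`.
  filter_upwards [hR.eventually_lt_σ hb hlim hdec hε 1] with k hk hacc hw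
  obtain ⟨r, hr, hr1, hσr⟩ := exists_mul_sq_eq_one one_pos (by norm_num : (1 : ℝ) * 1 ^ 2 = 1)
    (hk hacc hw).le
  have h1 : κ * r ≤ R.npred g P k := hnp g _ _ (hR.y_pos k) (hR.σ_pos k) (hR.normal k)
    (hb.conGrad_le k) (hb.y_le k) (hb.resid_le k) hw r hr hr1 hσr.le
  have h2 : ‖scale (R.st k).y (R.step k)‖ ≤ Cs * r := hst f g _ _ _ (hR.y_pos k) (hR.σ_pos k)
    (hR.normal k) (hR.tangent k) (hb.conGrad_le k) (hb.y_le k) (hb.gradient_le k) (hb.B_le k) r hr hr1 hσr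
  calc _ ≤ Cs * r := h2
    _ = Cs / κ * (κ * r) := by field_simp
    _ ≤ _ := by gcongr

/-- If the iterates converge, then iterations away from stationarity with a large regularisation
parameter are very successful. -/
lemma IsRun.exists_very_successful (hR : IsRun f g P R) (hf : ContDiff ℝ 1 f)
    (hg : ContDiff ℝ 1 g) {a b C G β : ℝ} (hb : RunBounds f g R a b C G β) {ε : ℝ} (hε : 0 < ε)
    {x₀ : E n} (hx : Tendsto (fun k => (R.st k).x) atTop (𝓝 x₀)) :
    ∃ S : ℝ, ∀ᶠ k in atTop, ε ≤ ‖R.residGrad g k‖ → S ≤ (R.st k).σ → P.η₂ ≤ R.rho f g P k := by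
  obtain ⟨κ, hκ, hnp⟩ := exists_mul_le_npred (n := n) (m := m) P hb.a_pos hb.b_pos hb.C_pos hε
  obtain ⟨Cs, hCs, hst⟩ := exists_scale_step_le (n := n) (m := m) P hb.a_pos hb.b_pos hb.G_pos
    hb.β_pos
  have hδ := P.δ_pos
  have hμ := P.μ_pos
  have hβ := hb.β_pos
  have hν0 := hR.ν_init
  have hτ : 0 < 1 - P.τ := by linarith [P.τ_lt]
  have hη : 0 < 1 - P.η₂ := by linarith [P.η₂_lt]
  -- The admissible error `(1 - η₂) δ ν κ r` equals `2 B ν r / νinit`: one `B` pays for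
  -- linearization, the other for the quadratic terms. The slope `ω` is fixed first, since it
  -- determines the radii that then restrict `r₀`.
  set B := (1 - P.η₂) * (P.δ * κ) * R.νinit / 2 with hB
  have hB0 : 0 < B := by positivity
  set Q := β + P.μ / (1 - P.τ) with hQ
  have hQ0 : 0 < Q := by positivity
  obtain ⟨ω, h1, hω⟩ := ((eventually_mul_le ((1 + R.νinit) * Cs) hB0).and
    self_mem_nhdsWithin).exists
  replace hω : 0 < ω := hω
  obtain ⟨ρf, hρf, hfe⟩ := exists_linearization_error_le hf x₀ hω
  obtain ⟨ρg, hρg, hge⟩ := exists_linearization_error_le hg x₀ hω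
  obtain ⟨r₀, ⟨⟨⟨h2, h3⟩, h4⟩, h5⟩, hr₀⟩ := (((((eventually_mul_le (Q * Cs ^ 2) hB0).and
    (eventually_mul_le 1 one_pos)).and (eventually_mul_le Cs (half_pos hρf))).and
    (eventually_mul_le Cs (half_pos hρg))).and self_mem_nhdsWithin).exists
  replace hr₀ : 0 < r₀ := hr₀
  have hx' := Metric.tendsto_nhds.1 hx (min ρf ρg) (by positivity)
  refine ⟨(r₀ ^ 2)⁻¹, ?_⟩
  filter_upwards [hx'] with k hk hw hS
  obtain ⟨r, hr, hr1, hσr⟩ := exists_mul_sq_eq_one hr₀ (inv_mul_cancel₀ (by positivity)) hS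
  have hr1' : r ≤ 1 := by linarith
  have hnk : κ * r ≤ R.npred g P k := hnp g _ _ (hR.y_pos k) (hR.σ_pos k) (hR.normal k)
    (hb.conGrad_le k) (hb.y_le k) (hb.resid_le k) hw r hr hr1' hσr.le
  have hsk : ‖scale (R.st k).y (R.step k)‖ ≤ Cs * r := hst f g _ _ _ (hR.y_pos k) (hR.σ_pos k)
    (hR.normal k) (hR.tangent k) (hb.conGrad_le k) (hb.y_le k) (hb.gradient_le k) (hb.B_le k) r hr
    hr1' hσr
  have hdx : ‖(R.step k).fst‖ ≤ r₀ * Cs := by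
    refine (norm_fst_le_scale (R.st k).y _).trans (hsk.trans ?_)
    rw [mul_comm]; gcongr
  rw [dist_eq_norm, lt_min_iff] at hk
  have hfk := hfe _ (R.step k).fst hk.1 (by linarith)
  have hgk := hge _ (R.step k).fst hk.2 (by linarith)
  have hfk' : |f ((R.st k).x + (R.step k).fst) - f (R.st k).x
      - inner ℝ (gradient f (R.st k).x) (R.step k).fst| ≤ ω * ‖(R.step k).fst‖ := by
    rwa [gradient, InnerProductSpace.toDual_symm_apply, ← Real.norm_eq_abs]
  have hν := hR.νinit_le k
  have hνk : 0 < R.ν k := hν0.trans_le hν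
  have hared := pred_sub_le_ared (P := P) (hR.y_pos k) (hR.σ_pos k) hνk.le hω.le
    (hR.step_boundary k) (hb.B_le k) hfk' hgk
  have hpred : P.δ * R.ν k * (κ * r) ≤ pred f g P (R.st k) (R.ν k) (R.step k) :=
    le_trans (by gcongr) (hR.mul_npred_le_pred k)
  have hpred0 : 0 < pred f g P (R.st k) (R.ν k) (R.step k) := lt_of_lt_of_le (by positivity) hpred
  set z := ‖scale (R.st k).y (R.step k)‖ with hz
  have hz0 : 0 ≤ z := norm_nonneg _
  have e1 : ω * (1 + R.ν k) * z * R.νinit ≤ R.ν k * r * B := by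
    have : (1 + R.ν k) * R.νinit ≤ R.ν k * (1 + R.νinit) := by linarith
    calc ω * (1 + R.ν k) * z * R.νinit = ω * ((1 + R.ν k) * R.νinit) * z := by ring
      _ ≤ ω * (R.ν k * (1 + R.νinit)) * (Cs * r) := by gcongr
      _ = R.ν k * r * (ω * ((1 + R.νinit) * Cs)) := by ring
      _ ≤ _ := by gcongr
  have e2 : Q * z ^ 2 * R.νinit ≤ R.ν k * r * B := by
    calc Q * z ^ 2 * R.νinit ≤ Q * (Cs * r) ^ 2 * R.ν k := by gcongr
      _ = R.ν k * r * (r * (Q * Cs ^ 2)) := by ring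
      _ ≤ R.ν k * r * (r₀ * (Q * Cs ^ 2)) := by gcongr
      _ ≤ _ := by gcongr
  have e3 : ω * (1 + R.ν k) * z + Q * z ^ 2 ≤ (1 - P.η₂) * (P.δ * R.ν k * (κ * r)) := by
    refine le_of_mul_le_mul_right ?_ hν0
    calc (ω * (1 + R.ν k) * z + Q * z ^ 2) * R.νinit ≤ R.ν k * r * B + R.ν k * r * B := by
          linarith
      _ = _ := by rw [hB]; ring
  have e4 := mul_le_mul_of_nonneg_left hpred hη.le
  rw [Run.rho, ratio, le_div_iff₀ hpred0]
  linarith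

/-- Large regularisation parameters cannot eventually both force success and be forced by it:
the first bounds the parameter, and then the second makes every late iteration fail. -/
lemma IsRun.false_of_eventually_successful (hR : IsRun f g P R) {S : ℝ}
    (hS : ∀ᶠ k in atTop, S ≤ (R.st k).σ → P.η₂ ≤ R.rho f g P k)
    (hacc : ∀ T, ∀ᶠ k in atTop, P.η₁ ≤ R.rho f g P k → T < (R.st k).σ) : False := by
  have hγ₁ := P.γ₁_gt
  have hγ₂ := P.γ₁_lt
  obtain ⟨K, hK⟩ := eventually_atTop.1 hS
  -- From `σ ≥ S` the parameter cannot increase; from below `S` one update reaches at most `γ₂ S`.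
  set T := max (R.st K).σ (P.γ₂ * S) with hT
  have hbd : ∀ k, K ≤ k → (R.st k).σ ≤ T := by
    intro k hk
    induction k, hk using Nat.le_induction with
    | base => exact le_max_left _ _
    | succ k hk ih =>
      have hσ := hR.σ_pos k
      rcases le_or_gt S (R.st k).σ with h | h
      · exact (hR.σ_very k (hK k hk h)).2.trans ih
      · refine le_trans ?_ (le_max_right _ _)
        suffices h' : (R.st (k + 1)).σ ≤ P.γ₂ * (R.st k).σ from
          h'.trans (mul_le_mul_of_nonneg_left h.le (by linarith))
        rcases lt_or_ge (R.rho f g P k) P.η₁ with h1 | h1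
        · exact (hR.σ_unsucc k h1).2
        · rcases lt_or_ge (R.rho f g P k) P.η₂ with h2 | h2
          · exact (hR.σ_succ k h1 h2).2.trans (mul_le_mul_of_nonneg_right hγ₂.le hσ.le)
          · exact (hR.σ_very k h2).2.trans (le_mul_of_one_le_left hσ.le (by linarith))
  obtain ⟨K', hK'⟩ := eventually_atTop.1 (hacc T)
  set M := max K K'
  -- Beyond `M` an accepted step would need `σ > T`, so every step is rejected and multiplies `σ` by
  -- at least `γ₁`.
  have hrej : ∀ j, P.γ₁ ^ j * (R.st M).σ ≤ (R.st (M + j)).σ := by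
    intro j
    induction j with
    | zero => simp
    | succ j ih =>
      have h1 : R.rho f g P (M + j) < P.η₁ := by
        by_contra! h
        have := hK' (M + j) ((le_max_right K K').trans (Nat.le_add_right _ _)) h
        exact absurd (hbd (M + j) ((le_max_left K K').trans (Nat.le_add_right _ _))) (not_le.2 this)
      refine le_trans ?_ (hR.σ_unsucc _ h1).1
      rw [pow_succ', mul_assoc]
      exact mul_le_mul_of_nonneg_left ih (by linarith)
  obtain ⟨j, hj⟩ := pow_unbounded_of_one_lt (T / (R.st M).σ) hγ₁
  rw [div_lt_iff₀ (hR.σ_pos M)] at hj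
  exact absurd (hbd (M + j) ((le_max_left K K').trans (Nat.le_add_right _ _)))
    (not_le.2 (hj.trans_le (hrej j)))

/-- Products of bounded Lipschitz quantities; `residGrad` cannot fall from `2ε` below `ε` unless the
iterates travel a definite distance. -/
lemma exists_residGrad_lipschitz (h1 : A1 f g R) {a b C G β : ℝ}
    (hb : RunBounds f g R a b C G β) :
    ∃ L > 0, ∀ j k, ‖R.residGrad g j - R.residGrad g k‖ ≤
      L * (‖(R.st j).x - (R.st k).x‖ + ‖(R.st j).y - (R.st k).y‖) := by
  obtain ⟨X, -, -, hX, -, -, -, ⟨Lg, hLg⟩, ⟨LA, hLA⟩⟩ := h1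
  have ha := hb.a_pos
  have hb0 := hb.b_pos
  have hC := hb.C_pos
  refine ⟨LA * C + a * (Lg + 1) + (C + b * (Lg + 1)), by positivity, fun j k => ?_⟩
  set u := ‖(R.st j).x - (R.st k).x‖ with hu
  set v := ‖(R.st j).y - (R.st k).y‖ with hv
  have hu0 : 0 ≤ u := norm_nonneg _
  have hv0 : 0 ≤ v := norm_nonneg _
  set cj := resid g (R.st j).x (R.st j).y with hcj
  set ck := resid g (R.st k).x (R.st k).y with hck
  have hgd : ‖cj - ck‖ ≤ (Lg + 1) * (u + v) := by
    have e1 : cj - ck = (g (R.st j).x - g (R.st k).x) + ((R.st j).y - (R.st k).y) := by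
      simp only [hcj, hck, resid]; abel
    have e2 := hLg.norm_sub_le (hX j) (hX k)
    rw [e1]
    refine (norm_add_le _ _).trans ?_
    have : 0 ≤ (Lg : ℝ) * v := by positivity
    linarith
  have hA : ‖conGrad g (R.st j).x cj - conGrad g (R.st k).x ck‖
      ≤ LA * u * C + a * ((Lg + 1) * (u + v)) := by
    have e1 : conGrad g (R.st j).x cj - conGrad g (R.st k).x ck
        = (conGrad g (R.st j).x - conGrad g (R.st k).x) cj + conGrad g (R.st k).x (cj - ck) := by
      simp
    rw [e1]
    refine (norm_add_le _ _).trans (add_le_add ?_ ?_)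
    · exact (ContinuousLinearMap.le_opNorm _ _).trans (mul_le_mul (hLA.norm_sub_le (hX j) (hX k))
        (hb.resid_le j) (norm_nonneg _) (by positivity))
    · exact (ContinuousLinearMap.le_opNorm _ _).trans (mul_le_mul (hb.conGrad_le k) hgd
        (norm_nonneg _) ha.le)
  have hY : ‖diagMul (R.st j).y cj - diagMul (R.st k).y ck‖ ≤ v * C + b * ((Lg + 1) * (u + v)) := by
    rw [diagMul_sub_diagMul]
    refine (norm_add_le _ _).trans (add_le_add ?_ ?_)
    · exact (norm_diagMul_le _ _).trans (mul_le_mul_of_nonneg_left (hb.resid_le j) hv0)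
    · exact (norm_diagMul_le _ _).trans (mul_le_mul (hb.y_le k) hgd (norm_nonneg _) hb0.le)
  have hst : R.residGrad g j - R.residGrad g k
      = stack (conGrad g (R.st j).x cj - conGrad g (R.st k).x ck)
          (diagMul (R.st j).y cj - diagMul (R.st k).y ck) := rfl
  rw [hst]
  refine (norm_stack_le _ _).trans ((add_le_add hA hY).trans ?_)
  have e1 : 0 ≤ LA * C * v := by positivity
  have e2 : 0 ≤ C * u := by positivity
  linarith

lemma IsRun.norm_succ_sub_le (hR : IsRun f g P R) {b : ℝ} (hb : ∀ k, ‖(R.st k).y‖ ≤ b) {k : ℕ}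
    (hk : P.η₁ ≤ R.rho f g P k) :
    ‖(R.st (k + 1)).x - (R.st k).x‖ + ‖(R.st (k + 1)).y - (R.st k).y‖
      ≤ (1 + b) * ‖scale (R.st k).y (R.step k)‖ := by
  rw [(hR.accept k hk).1, (hR.accept k hk).2, add_sub_cancel_left, add_sub_cancel_left]
  have h1 := norm_fst_le_scale (R.st k).y (R.step k)
  have h2 := (norm_snd_le_scale (hR.y_pos k) (R.step k)).trans
    (mul_le_mul_of_nonneg_right (hb k) (norm_nonneg _))
  linarith

theorem IsRun.tendsto_residGrad (hf : ContDiff ℝ 1 f) (hg : ContDiff ℝ 1 g) (hR : IsRun f g P R)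
    (h1 : A1 f g R) (h2 : A2 f g R) : Tendsto (R.residGrad g) atTop (𝓝 0) := by
  obtain ⟨Ψ, hΨ, hc, hdec⟩ := hR.exists_lyapunov h2.1 h2.2.2.1
  obtain ⟨a, b, C, G, β, hb⟩ := exists_runBounds h2 hΨ hc
  have hΨ0 : ∀ k, 0 ≤ Ψ k := fun k => (norm_nonneg _).trans (hc k)
  have hlim := tendsto_sub_succ hΨ hΨ0
  obtain ⟨L, hL, hLip⟩ := exists_residGrad_lipschitz h1 hb
  have hb0 := hb.b_pos
  have hη := P.η₁_pos
  have hδ := P.δ_pos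
  rw [Metric.tendsto_nhds]
  by_contra! hcon
  obtain ⟨ε', hε', hcon⟩ := hcon
  obtain ⟨ε, hε, rfl⟩ : ∃ ε > 0, ε' = 2 * ε := ⟨ε' / 2, by positivity, by ring⟩
  obtain ⟨D, hD, hstep⟩ := hR.exists_step_le_npred hb hlim hdec hε
  -- The factors convert, in turn, displacement to scaled step, scaled step to `npred`, and `npred`
  -- to the drop of `Ψ`.
  set D' := (1 + b) * D / (P.η₁ * P.δ) with hD'
  have hD'0 : 0 < D' := by positivity
  have hlimΨ := tendsto_atTop_ciInf hΨ ⟨0, Set.forall_mem_range.2 hΨ0⟩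
  obtain ⟨K₀, hK₀⟩ := eventually_atTop.1 hstep
  -- The remaining drop of `Ψ` is below `ε / (L D')`, so a path of length at most `D'` times that
  -- drop changes `residGrad` by at most `ε`.
  obtain ⟨K, hK, hKw, hKΨ⟩ : ∃ K, K₀ ≤ K ∧ 2 * ε ≤ ‖R.residGrad g K‖ ∧
      Ψ K < iInf Ψ + ε / (L * D') := by
    obtain ⟨K, hK, hK1, hK2⟩ := (hcon.and_eventually ((eventually_ge_atTop K₀).and
      (hlimΨ.eventually (gt_mem_nhds (lt_add_of_pos_right (iInf Ψ)
        (show 0 < ε / (L * D') by positivity)))))).exists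
    exact ⟨K, hK1, by simpa using hK, hK2⟩
  have hmove : ∀ k, K ≤ k → ε ≤ ‖R.residGrad g k‖ →
      ‖(R.st (k + 1)).x - (R.st k).x‖ + ‖(R.st (k + 1)).y - (R.st k).y‖
        ≤ D' * (Ψ k - Ψ (k + 1)) := by
    intro k hk hw
    rcases lt_or_ge (R.rho f g P k) P.η₁ with h | h
    · rw [(hR.reject k h).1, (hR.reject k h).2, sub_self, sub_self, norm_zero, norm_zero, add_zero]
      exact mul_nonneg hD'0.le (sub_nonneg.2 (hΨ k.le_succ))
    · calc _ ≤ (1 + b) * ‖scale (R.st k).y (R.step k)‖ := hR.norm_succ_sub_le hb.y_le h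
        _ ≤ (1 + b) * (D * R.npred g P k) := by gcongr; exact hK₀ k (hK.trans hk) h hw
        _ = D' * (P.η₁ * P.δ * R.npred g P k) := by rw [hD']; field_simp
        _ ≤ _ := by gcongr; exact hdec k h
  have hfar : ∀ k, ‖(R.st k).x - (R.st K).x‖ + ‖(R.st k).y - (R.st K).y‖ ≤ D' * (Ψ K - Ψ k) →
      ε ≤ ‖R.residGrad g k‖ := by
    intro k hk
    have e1 : L * (D' * (Ψ K - Ψ k)) ≤ ε := by
      have : Ψ K - Ψ k ≤ ε / (L * D') := by
        linarith [ciInf_le (⟨0, Set.forall_mem_range.2 hΨ0⟩ : BddBelow (Set.range Ψ)) k]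
      rw [le_div_iff₀ (by positivity)] at this
      linarith
    have e2 := (hLip k K).trans (mul_le_mul_of_nonneg_left hk hL.le)
    have e3 := norm_sub_norm_le (R.residGrad g K) (R.residGrad g k)
    rw [norm_sub_rev] at e3
    linarith
  -- Bootstrap: the distance bound at `k` keeps `residGrad` above `ε` by `hfar`, which permits
  -- `hmove` to extend the bound to `k + 1`.
  have hnear : ∀ k, K ≤ k →
      ‖(R.st k).x - (R.st K).x‖ + ‖(R.st k).y - (R.st K).y‖ ≤ D' * (Ψ K - Ψ k) := by
    intro k hk
    induction k, hk using Nat.le_induction with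
    | base => simp
    | succ k hk ih =>
      have e1 := hmove k hk (hfar k ih)
      have e2 := norm_sub_le_norm_sub_add_norm_sub (R.st (k + 1)).x (R.st k).x (R.st K).x
      have e3 := norm_sub_le_norm_sub_add_norm_sub (R.st (k + 1)).y (R.st k).y (R.st K).y
      linarith
  have haway : ∀ k, K ≤ k → ε ≤ ‖R.residGrad g k‖ := fun k hk => hfar k (hnear k hk)
  -- The step lengths are dominated by a telescoping sum, so the path has finite length.
  have hsum : Summable fun j => D' * (Ψ (K + j) - Ψ (K + (j + 1))) := by
    refine (summable_of_sum_range_le (c := Ψ K)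
      (fun j => sub_nonneg.2 (hΨ (by omega))) fun N => ?_).mul_left D'
    rw [Finset.sum_range_sub' (fun j => Ψ (K + j))]
    simpa using hΨ0 (K + N)
  have hcau : CauchySeq fun j => (R.st (K + j)).x := by
    refine cauchySeq_of_dist_le_of_summable _ (fun j => ?_) hsum
    have e1 := hmove (K + j) (Nat.le_add_right _ _) (haway _ (Nat.le_add_right _ _))
    rw [dist_comm, dist_eq_norm]
    exact (le_add_of_nonneg_right (norm_nonneg _)).trans e1
  obtain ⟨x₀, hx₀⟩ := cauchySeq_tendsto_of_complete hcau
  have hx : Tendsto (fun k => (R.st k).x) atTop (𝓝 x₀) := by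
    rw [← tendsto_add_atTop_iff_nat K]
    simpa only [add_comm] using hx₀
  obtain ⟨S, hS⟩ := hR.exists_very_successful hf hg hb hε hx
  refine hR.false_of_eventually_successful (S := S) ?_ fun T => ?_
  · filter_upwards [hS, eventually_ge_atTop K] with k hk hkK using hk (haway k hkK)
  · filter_upwards [hR.eventually_lt_σ hb hlim hdec hε T, eventually_ge_atTop K] with k hk hkK h
    exact hk h (haway k hkK)

end Run

end ARCBIP

theorem theorem1 {n m : ℕ} (f : ARCBIP.E n → ℝ) (g : ARCBIP.E n → ARCBIP.E m)
    (hf : ContDiff ℝ 1 f) (hg : ContDiff ℝ 1 g)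
    (P : ARCBIP.Params) (R : ARCBIP.Run n m) (hR : ARCBIP.IsRun f g P R)
    (h1 : ARCBIP.A1 f g R) (h2 : ARCBIP.A2 f g R) (h3 : ARCBIP.A3 R) :
    Tendsto
      (fun k => ARCBIP.stack
        (ARCBIP.conGrad g (R.st k).x (g (R.st k).x + (R.st k).y))
        (ARCBIP.diagMul (R.st k).y (g (R.st k).x + (R.st k).y)))
      atTop (𝓝 (0 : ARCBIP.Stack n m)) := by
  exact hR.tendsto_residGrad hf hg h1 h2
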